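/- Let $n\ge 2$ be an integer and $w>1$. Let $P_n^w$ be the path on vertices $1,\dots,n$ (with all edge weights equal to $1$) with a loop of weight $w$ added at each of the end vertices $1$ and $n$. Let $A(w)$ be its adjacency matrix, i.e. the real symmetric $n\times n$ matrix with $A(w)_{j,j+1}=A(w)_{j+1,j}=1$ for $1\le j\le n-1$, $A(w)_{1,1}=A(w)_{n,n}=w$ and all other entries $0$, and let $\lambda_1\ge\lambda_2\ge\cdots\ge\lambda_n$ be its eigenvalues. For $t>0$ let $p(t)=\left|\left(e^{itA(w)}\right)_{1,n}\right|^2$ be the fidelity of state transfer from vertex $1$ to vertex $n$ at time $t$. Put $$\tau_n=\frac{(w+1)^2(w-1)}{w\left(w^{2\lceil n/2\rceil}-1\right)},\qquad b(x)=\left(\frac{x+\sqrt{x^2-4}}{\sqrt{x^2-4}}+\frac{16}{(n-1)(x^2-4)}\right)^{-1}\quad (x>2).$$ Suppose that $w+\frac1w-\tau_n>2$, let $t>0$, and set $\alpha=t(\lambda_1-\lambda_2)$, $b_1=b\left(w+\frac1w\right)$ and $b_2=b\left(w+\frac1w-\tau_n\right)$. Then $$p(t)\le\left(\sqrt{b_1^2+b_2^2-2b_1b_2\cos\alpha}+1-b_1-b_2\right)^2.$$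 -/

import Mathlib

/-- The adjacency matrix `A(w)` of `P_n^w`: the unweighted path on `n` vertices (here indexed by
`0, …, n - 1`) with a loop of weight `w` at each of the two end vertices. -/
noncomputable def loopedPathMatrix (n : ℕ) (w : ℝ) : Matrix (Fin n) (Fin n) ℝ :=
  Matrix.of fun i j =>
    if i.val + 1 = j.val ∨ j.val + 1 = i.val then 1
    else if i = j ∧ (i.val = 0 ∨ i.val + 1 = n) then w
    else 0

theorem loopedPathMatrix_isHermitian (n : ℕ) (w : ℝ) : (loopedPathMatrix n w).IsHermitian := by
  ext i j
  simp only [Matrix.conjTranspose_apply, loopedPathMatrix, Matrix.of_apply, star_trivial]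
  by_cases h : i = j
  · subst h; rfl
  · have h' : ¬ j = i := fun e => h e.symm
    simp only [h, h', false_and, if_false, or_comm]

/-- The eigenvalues of `A(w)`, with multiplicity, in nonincreasing order: index `k` (counted from
`0`) gives the `(k + 1)`-st largest one. -/
noncomputable def loopedPathEigenvalue (n : ℕ) (w : ℝ) (k : Fin n) : ℝ :=
  (loopedPathMatrix_isHermitian n w).eigenvalues₀ (Fin.cast (Fintype.card_fin n).symm k)

/-- The transition matrix `U(t) = exp(i t A)` of the Hamiltonian `A`. -/
noncomputable def transitionMatrix {n : ℕ} (A : Matrix (Fin n) (Fin n) ℝ) (t : ℝ) :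
    Matrix (Fin n) (Fin n) ℂ :=
  NormedSpace.exp ((Complex.I * (t : ℂ)) • A.map ((↑) : ℝ → ℂ))

/-- The fidelity of state transfer `|U(t)_{a,b}|²` from `a` to `b` at time `t`. -/
noncomputable def transferFidelity {n : ℕ} (A : Matrix (Fin n) (Fin n) ℝ) (a b : Fin n) (t : ℝ) :
    ℝ :=
  ‖transitionMatrix A t a b‖ ^ 2

/-- `τ_n = (w + 1)² (w - 1) / (w (w ^ (2 ⌈n / 2⌉) - 1))`. -/
noncomputable def tauN (n : ℕ) (w : ℝ) : ℝ :=
  (w + 1) ^ 2 * (w - 1) / (w * (w ^ (2 * ⌈(n : ℝ) / 2⌉₊) - 1))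

/-- The function `b` (for the given `n`), meant for `x > 2`. -/
noncomputable def bFun (n : ℕ) (x : ℝ) : ℝ :=
  ((x + √(x ^ 2 - 4)) / √(x ^ 2 - 4) + 16 / (((n : ℝ) - 1) * (x ^ 2 - 4)))⁻¹

/-! Expand the corner entry of exp(itA) in an orthonormal eigenbasis. If the first eigenvector is
symmetric and the second antisymmetric under reversal of the path, with squared end entries x and y,
their two terms add up to modulus |x e^{iα} - y|, and the other terms add at most 1 - x - y by
AM-GM. When x ≥ b₁ and y ≥ b₂, the triangle inequality replaces x and y by b₁ and b₂
(`transferFidelity_le`). What remains is to bound the two end entries from below.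

An eigenvector with eigenvalue q + 1/q, q > 1, is a multiple of q^k + q^(n+1-k) or of q^k -
q^(n+1-k) (`eigenvector_eq_geomSeq`), so its norm relative to its end entry is explicit. In the
symmetric case the term of b with the constant 16 absorbs the cross terms (`symmetric_sum_sq_le`);
in the antisymmetric case the cross terms are negative and no correction is needed
(`antisymmetric_sum_sq_le`). Since b is increasing, Rayleigh quotients finish the argument: λ₁ ≥ w +
1/w always, and λ₂ ≥ w + 1/w - τ for even n, where τ is exactly the loss in the Rayleigh quotient of
a vector decaying geometrically from each end towards the middle.

For odd n the estimate of λ₂ can fail: for n = 3, λ₂ = w is smaller than w + 1/w - τ. The correction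
term unused by the antisymmetric vector makes up for it. With n = 2h + 1 and h ≥ 2, either h(w² - 1)
≥ 4 and `exists_ratio` converts that slack into a weaker but sufficient bound on λ₂, or b is so
small that comparison with a linear vector suffices (`bFun_le_linear`). The case n = 3 is computed
directly. -/

open Matrix

/-! ### Spectral decomposition of the transition matrix -/

/-- A real symmetric matrix is diagonalized by an orthogonal matrix whose rows are eigenvectors
listed in the order of nonincreasing eigenvalues. -/
theorem exists_orthogonal_diagonalization {n : ℕ} {A : Matrix (Fin n) (Fin n) ℝ}
    (hA : A.IsHermitian) :
    ∃ V : Matrix (Fin n) (Fin n) ℝ, V * Vᵀ = 1 ∧ A = Vᵀ *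
      diagonal (fun k => hA.eigenvalues₀ (Fin.cast (Fintype.card_fin n).symm k)) * V := by
  -- `eigenvalues` is `eigenvalues₀` transported along an arbitrary bijection of index types; `e`
  -- undoes that choice, so that the rows come out in decreasing order.
  let e : Fin n ≃ Fin n := (finCongr (Fintype.card_fin n).symm).trans
    (Fintype.equivOfCardEq (Fintype.card_fin _))
  have he : ∀ k, hA.eigenvalues (e k) =
      hA.eigenvalues₀ (Fin.cast (Fintype.card_fin n).symm k) := by
    intro k
    simp [IsHermitian.eigenvalues, e]
  let V : Matrix (Fin n) (Fin n) ℝ := Matrix.of fun k i => hA.eigenvectorBasis (e k) i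
  have hV : V * Vᵀ = 1 := by
    ext k l
    have h := (orthonormal_iff_ite.mp hA.eigenvectorBasis.orthonormal) (e k) (e l)
    simp only [PiLp.inner_apply, RCLike.inner_apply, conj_trivial, EmbeddingLike.apply_eq_iff_eq]
      at h
    rw [mul_apply, one_apply, ← h]
    exact Finset.sum_congr rfl fun i _ => by simp [V, mul_comm]
  have hV' : Vᵀ * V = 1 := mul_eq_one_comm.mp hV
  refine ⟨V, hV, ?_⟩
  have hAV : A * Vᵀ = Vᵀ *
      diagonal (fun k => hA.eigenvalues₀ (Fin.cast (Fintype.card_fin n).symm k)) := by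
    ext i k
    have h := congrFun (hA.mulVec_eigenvectorBasis (e k)) i
    rw [mul_diagonal, ← he]
    simpa [mulVec, dotProduct, mul_apply, V, mul_comm] using h
  rw [← hAV, mul_assoc, hV', mul_one]

/-- Spectral decomposition of the entries of the transition matrix. -/
theorem transitionMatrix_apply {n : ℕ} {A V : Matrix (Fin n) (Fin n) ℝ} {l : Fin n → ℝ}
    (hV : V * Vᵀ = 1) (hA : A = Vᵀ * diagonal l * V) (t : ℝ) (a b : Fin n) :
    transitionMatrix A t a b =
      ∑ k, Complex.exp ((t * l k : ℝ) * Complex.I) * ((V k a * V k b : ℝ) : ℂ) := by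
  let W : Matrix (Fin n) (Fin n) ℂ := V.map Complex.ofRealHom
  have hW : W * Wᵀ = 1 := by
    have := congrArg (fun M => M.map Complex.ofRealHom) hV
    simpa [W, Matrix.map_mul, transpose_map] using this
  have hW' : Wᵀ * W = 1 := mul_eq_one_comm.mp hW
  have hinv : W⁻¹ = Wᵀ := inv_eq_right_inv hW
  have hAW : (Complex.I * (t : ℂ)) • A.map ((↑) : ℝ → ℂ) =
      W⁻¹ * diagonal (fun k => ((t * l k : ℝ) : ℂ) * Complex.I) * W := by
    have h1 : A.map ((↑) : ℝ → ℂ) = Wᵀ * diagonal (fun k => (l k : ℂ)) * W := by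
      have := congrArg (fun M => M.map Complex.ofRealHom) hA
      simp only [Matrix.map_mul] at this
      rw [diagonal_map (map_zero _)] at this
      exact this
    have h2 : diagonal (fun k => ((t * l k : ℝ) : ℂ) * Complex.I) =
        (Complex.I * (t : ℂ)) • diagonal (fun k => (l k : ℂ)) := by
      rw [← diagonal_smul]
      congr 1
      funext k
      simp
      ring
    rw [h1, h2, hinv]
    simp
  have hu : IsUnit W := IsUnit.of_mul_eq_one _ hW
  rw [transitionMatrix, hAW, exp_conj' _ _ hu, exp_diagonal, hinv, mul_apply]
  refine Finset.sum_congr rfl fun k _ => ?_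
  rw [mul_diagonal, Pi.coe_exp, ← Complex.exp_eq_exp_ℂ]
  simp [W]
  ring

/-! ### Variational bounds for the two largest eigenvalues -/

section Rayleigh

variable {n : ℕ} {A V : Matrix (Fin n) (Fin n) ℝ} {l : Fin n → ℝ}

theorem mulVec_row_of_diagonalization (hV : V * Vᵀ = 1) (hA : A = Vᵀ * diagonal l * V)
    (k : Fin n) : A *ᵥ V k = l k • V k := by
  have hAV : A * Vᵀ = Vᵀ * diagonal l := by rw [hA, mul_assoc, hV, mul_one]
  ext i
  have := congrFun (congrFun hAV i) k
  rw [mul_diagonal, mul_apply] at this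
  simpa [mulVec, dotProduct, mul_comm] using this

theorem dotProduct_row_of_orthogonal (hV : V * Vᵀ = 1) (k m : Fin n) :
    V k ⬝ᵥ V m = if k = m then 1 else 0 := by
  have := congrFun (congrFun hV k) m
  rw [one_apply] at this
  simpa [mul_apply, dotProduct] using this

theorem sum_sq_column_of_orthogonal (hV : V * Vᵀ = 1) (i : Fin n) : ∑ k, V k i ^ 2 = 1 := by
  have := congrFun (congrFun (mul_eq_one_comm.mp hV : Vᵀ * V = 1) i) i
  rw [one_apply, if_pos rfl, mul_apply] at this
  rw [← this]
  exact Finset.sum_congr rfl fun k _ => by rw [transpose_apply, sq]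

theorem dotProduct_self_eq_sum_sq (hV : V * Vᵀ = 1) (g : Fin n → ℝ) :
    g ⬝ᵥ g = ∑ k, (V k ⬝ᵥ g) ^ 2 := by
  have h : (V *ᵥ g) ⬝ᵥ (V *ᵥ g) = g ⬝ᵥ g := by
    rw [dotProduct_mulVec, ← mulVec_transpose, mulVec_mulVec, mul_eq_one_comm.mp hV, one_mulVec]
  rw [← h, dotProduct]
  exact Finset.sum_congr rfl fun k _ => (sq _).symm

theorem quadratic_form_eq_sum (hA : A = Vᵀ * diagonal l * V) (g : Fin n → ℝ) :
    g ⬝ᵥ (A *ᵥ g) = ∑ k, l k * (V k ⬝ᵥ g) ^ 2 := by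
  have h : g ⬝ᵥ (A *ᵥ g) = (V *ᵥ g) ⬝ᵥ (diagonal l *ᵥ (V *ᵥ g)) := by
    rw [hA, ← mulVec_mulVec, ← mulVec_mulVec, dotProduct_mulVec, vecMul_transpose]
  rw [h, dotProduct]
  refine Finset.sum_congr rfl fun k _ => ?_
  rw [mulVec_diagonal]
  simp only [mulVec]
  ring

theorem le_first_eigenvalue (hV : V * Vᵀ = 1) (hA : A = Vᵀ * diagonal l * V)
    {i₀ : Fin n} (hl : ∀ k, l k ≤ l i₀) {g : Fin n → ℝ} {y : ℝ} (hg : 0 < g ⬝ᵥ g)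
    (hy : y * (g ⬝ᵥ g) ≤ g ⬝ᵥ (A *ᵥ g)) : y ≤ l i₀ := by
  rw [quadratic_form_eq_sum hA] at hy
  have h : ∑ k, l k * (V k ⬝ᵥ g) ^ 2 ≤ l i₀ * (g ⬝ᵥ g) := by
    rw [dotProduct_self_eq_sum_sq hV, Finset.mul_sum]
    exact Finset.sum_le_sum fun k _ => mul_le_mul_of_nonneg_right (hl k) (sq_nonneg _)
  exact le_of_mul_le_mul_right (hy.trans h) hg

/-- The max-min principle for the second eigenvalue, with two orthogonal and conjugate test
vectors. -/
theorem le_second_eigenvalue (hV : V * Vᵀ = 1) (hA : A = Vᵀ * diagonal l * V)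
    {i₀ i₁ : Fin n} (hl : ∀ k, k ≠ i₀ → l k ≤ l i₁) {f g : Fin n → ℝ} {y : ℝ}
    (hf : 0 < f ⬝ᵥ f) (hg : 0 < g ⬝ᵥ g) (hfg : f ⬝ᵥ g = 0)
    (hAfg : f ⬝ᵥ (A *ᵥ g) = 0) (hAgf : g ⬝ᵥ (A *ᵥ f) = 0)
    (hyf : y * (f ⬝ᵥ f) ≤ f ⬝ᵥ (A *ᵥ f)) (hyg : y * (g ⬝ᵥ g) ≤ g ⬝ᵥ (A *ᵥ g)) : y ≤ l i₁ := by
  -- The span of `f` and `g` is two-dimensional, so it contains a nonzero vector orthogonal to the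
  -- top eigenvector.
  obtain ⟨α, β, hαβ, hc⟩ : ∃ α β : ℝ, 0 < α ^ 2 + β ^ 2 ∧
      α * (V i₀ ⬝ᵥ f) + β * (V i₀ ⬝ᵥ g) = 0 := by
    by_cases h : V i₀ ⬝ᵥ f = 0
    · exact ⟨1, 0, by norm_num, by simp [h]⟩
    · exact ⟨V i₀ ⬝ᵥ g, -(V i₀ ⬝ᵥ f), by rw [neg_sq]; positivity, by ring⟩
  set s : Fin n → ℝ := α • f + β • g with hs
  have hss : s ⬝ᵥ s = α ^ 2 * (f ⬝ᵥ f) + β ^ 2 * (g ⬝ᵥ g) := by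
    have hgf : g ⬝ᵥ f = 0 := by rw [dotProduct_comm, hfg]
    simp only [hs, add_dotProduct, dotProduct_add, smul_dotProduct, dotProduct_smul, smul_eq_mul,
      hfg, hgf]
    ring
  have hAs : s ⬝ᵥ (A *ᵥ s) = α ^ 2 * (f ⬝ᵥ (A *ᵥ f)) + β ^ 2 * (g ⬝ᵥ (A *ᵥ g)) := by
    simp only [hs, mulVec_add, mulVec_smul, add_dotProduct, dotProduct_add, smul_dotProduct,
      dotProduct_smul, smul_eq_mul, hAfg, hAgf]
    ring
  have hpos : 0 < s ⬝ᵥ s := by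
    rw [hss]
    by_cases h : α = 0
    · subst h
      have : 0 < β ^ 2 := by simpa using hαβ
      positivity
    · positivity
  have h0 : V i₀ ⬝ᵥ s = 0 := by simpa [hs] using hc
  have hle : s ⬝ᵥ (A *ᵥ s) ≤ l i₁ * (s ⬝ᵥ s) := by
    rw [quadratic_form_eq_sum hA, dotProduct_self_eq_sum_sq hV, Finset.mul_sum]
    refine Finset.sum_le_sum fun k _ => ?_
    by_cases hk : k = i₀
    · subst hk
      simp [h0]
    · exact mul_le_mul_of_nonneg_right (hl k hk) (sq_nonneg _)
  have hge : y * (s ⬝ᵥ s) ≤ s ⬝ᵥ (A *ᵥ s) := by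
    rw [hss, hAs]
    nlinarith [mul_le_mul_of_nonneg_left hyf (sq_nonneg α),
      mul_le_mul_of_nonneg_left hyg (sq_nonneg β)]
  exact le_of_mul_le_mul_right (hge.trans hle) hpos

end Rayleigh

/-! ### From two eigenvectors to the fidelity -/

/-- If two eigenvectors, one symmetric and one antisymmetric with respect to `a` and `b`, have
squared entries at `a` bounded below by `b₁` and `b₂`, then the fidelity of transfer from `a` to `b`
is bounded in terms of the difference of their two eigenvalues. -/
theorem transferFidelity_le {n : ℕ} {A V : Matrix (Fin n) (Fin n) ℝ} {l : Fin n → ℝ}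
    (hV : V * Vᵀ = 1) (hA : A = Vᵀ * diagonal l * V) {i₀ i₁ a b : Fin n} (hi : i₀ ≠ i₁)
    (h₀ : V i₀ b = V i₀ a) (h₁ : V i₁ b = -V i₁ a) {b₁ b₂ : ℝ}
    (hb₁ : b₁ ≤ V i₀ a ^ 2) (hb₂ : b₂ ≤ V i₁ a ^ 2) (t : ℝ) :
    transferFidelity A a b t ≤
      (√(b₁ ^ 2 + b₂ ^ 2 - 2 * b₁ * b₂ * Real.cos (t * (l i₀ - l i₁))) + 1 - b₁ - b₂) ^ 2 := by
  rw [transferFidelity, transitionMatrix_apply hV hA]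
  refine pow_le_pow_left₀ (norm_nonneg _) ?_ 2
  set s : Finset (Fin n) := (Finset.univ.erase i₀).erase i₁ with hs
  have hmem : i₁ ∈ Finset.univ.erase i₀ := Finset.mem_erase.mpr ⟨hi.symm, Finset.mem_univ _⟩
  have hsplit : ∀ {M : Type} [AddCommMonoid M] (F : Fin n → M),
      ∑ k, F k = F i₀ + (F i₁ + ∑ k ∈ s, F k) := by
    intro M _ F
    rw [hs, Finset.add_sum_erase _ _ hmem, Finset.add_sum_erase _ _ (Finset.mem_univ _)]
  rw [hsplit]
  have hrest : ‖∑ k ∈ s, Complex.exp ((t * l k : ℝ) * Complex.I) * ((V k a * V k b : ℝ) : ℂ)‖ ≤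
      1 - V i₀ a ^ 2 - V i₁ a ^ 2 := by
    have hsa := sum_sq_column_of_orthogonal hV a
    have hsb := sum_sq_column_of_orthogonal hV b
    rw [hsplit] at hsa hsb
    rw [h₀, h₁] at hsb
    calc _ ≤ ∑ k ∈ s, (V k a ^ 2 + V k b ^ 2) / 2 := by
          refine norm_sum_le_of_le _ fun k _ => ?_
          rw [norm_mul, Complex.norm_exp_ofReal_mul_I, one_mul, Complex.norm_real,
            Real.norm_eq_abs, abs_le]
          constructor <;> nlinarith [sq_nonneg (V k a + V k b), sq_nonneg (V k a - V k b)]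
      _ = _ := by
          rw [← Finset.sum_div, Finset.sum_add_distrib]
          linarith
  set α := t * (l i₀ - l i₁) with hα
  have hmain : ‖(b₁ : ℂ) * Complex.exp (α * Complex.I) - b₂‖ =
      √(b₁ ^ 2 + b₂ ^ 2 - 2 * b₁ * b₂ * Real.cos α) := by
    rw [Complex.norm_def, Complex.normSq_apply, Complex.exp_mul_I, ← Complex.ofReal_cos,
      ← Complex.ofReal_sin]
    congr 1
    simp only [Complex.sub_re, Complex.sub_im, Complex.mul_re, Complex.mul_im, Complex.add_re,
      Complex.add_im, Complex.ofReal_re, Complex.ofReal_im, Complex.I_re, Complex.I_im]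
    nlinarith [Real.sin_sq_add_cos_sq α]
  -- After a common phase is taken out, the sum splits into the part with weights exactly `b₁`, `b₂`
  -- and an excess with nonnegative weights.
  have hfac : Complex.exp ((t * l i₀ : ℝ) * Complex.I) * ((V i₀ a * V i₀ b : ℝ) : ℂ) +
      Complex.exp ((t * l i₁ : ℝ) * Complex.I) * ((V i₁ a * V i₁ b : ℝ) : ℂ) =
      Complex.exp ((t * l i₁ : ℝ) * Complex.I) *
        (((b₁ : ℂ) * Complex.exp (α * Complex.I) - b₂) +
          (((V i₀ a ^ 2 - b₁ : ℝ) : ℂ) * Complex.exp (α * Complex.I)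
            - ((V i₁ a ^ 2 - b₂ : ℝ) : ℂ))) := by
    have : Complex.exp ((t * l i₀ : ℝ) * Complex.I) =
        Complex.exp ((t * l i₁ : ℝ) * Complex.I) * Complex.exp (α * Complex.I) := by
      rw [← Complex.exp_add]
      congr 1
      rw [hα]
      push_cast
      ring
    rw [this, h₀, h₁]
    push_cast
    ring
  have hextra : ‖((V i₀ a ^ 2 - b₁ : ℝ) : ℂ) * Complex.exp (α * Complex.I)
      - ((V i₁ a ^ 2 - b₂ : ℝ) : ℂ)‖ ≤ (V i₀ a ^ 2 - b₁) + (V i₁ a ^ 2 - b₂) := by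
    refine (norm_sub_le _ _).trans ?_
    rw [norm_mul, Complex.norm_exp_ofReal_mul_I, mul_one, Complex.norm_real, Complex.norm_real,
      Real.norm_of_nonneg (by linarith), Real.norm_of_nonneg (by linarith)]
  rw [← add_assoc, hfac]
  refine (norm_add_le _ _).trans ?_
  rw [norm_mul, Complex.norm_exp_ofReal_mul_I, one_mul]
  have := norm_add_le ((b₁ : ℂ) * Complex.exp (α * Complex.I) - b₂)
    (((V i₀ a ^ 2 - b₁ : ℝ) : ℂ) * Complex.exp (α * Complex.I) - ((V i₁ a ^ 2 - b₂ : ℝ) : ℂ))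
  rw [hmain] at this
  linarith

/-! ### Vectors as sequences with one extra value beyond each end -/

/-- The vector on `Fin n` obtained from a sequence `G 0, …, G (n + 1)` by dropping both ends. -/
def innerVec (n : ℕ) (G : ℕ → ℝ) : Fin n → ℝ := fun i => G (i + 1)

/-- The extra values G 0 and G (n + 1) let every row act as a sum of two neighbours; the loops enter
only through the boundary defects w G 1 - G 0 and w G n - G (n + 1). -/
theorem loopedPathMatrix_mulVec_innerVec {n : ℕ} (hn : 2 ≤ n) (w : ℝ) (G : ℕ → ℝ) (i : Fin n) :
    (loopedPathMatrix n w *ᵥ innerVec n G) i = G i + G (i + 2) +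
      (if i.val = 0 then w * G 1 - G 0 else 0) +
      (if i.val + 1 = n then w * G n - G (n + 1) else 0) := by
  have hA : ∀ j : Fin n, loopedPathMatrix n w i j * innerVec n G j =
      (if i.val + 1 = j.val then G (i + 2) else 0) + (if j.val + 1 = i.val then G i else 0) +
      (if i.val = j.val then (if i.val = 0 then w * G 1 else 0) +
        (if i.val + 1 = n then w * G n else 0) else 0) := by
    intro j
    simp only [loopedPathMatrix, of_apply, innerVec, Fin.ext_iff]
    by_cases h1 : i.val + 1 = j.val
    · have h2 : ¬ (j.val + 1 = i.val) := by omega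
      have h3 : ¬ (i.val = j.val) := by omega
      simp [h1, h2, h3, show i.val + 2 = j.val + 1 by omega]
    · by_cases h2 : j.val + 1 = i.val
      · have h3 : ¬ (i.val = j.val) := by omega
        simp [h1, h2, h3]
      · by_cases h3 : i.val = j.val
        · have h1' : ¬ (j.val + 1 = j.val) := by omega
          by_cases h4 : j.val = 0
          · have h5 : ¬ (0 + 1 = n) := by omega
            simp [h3, h4, h5]
          · by_cases h5 : j.val + 1 = n
            · simp [h3, h4, h5, show ¬ n = j.val by omega]
            · simp [h3, h4, h5]
        · simp [h1, h2, h3]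
  rw [mulVec, dotProduct, Finset.sum_congr rfl fun j _ => hA j, Finset.sum_add_distrib,
    Finset.sum_add_distrib]
  have s1 : ∑ j : Fin n, (if i.val + 1 = j.val then G (i + 2) else 0) =
      if i.val + 1 = n then 0 else G (i + 2) := by
    by_cases h : i.val + 1 = n
    · rw [if_pos h]
      exact Finset.sum_eq_zero fun j _ => if_neg (by omega)
    · rw [if_neg h, Finset.sum_eq_single (⟨i.val + 1, by omega⟩ : Fin n)]
      · simp
      · intro j _ hj
        exact if_neg fun h' => hj (Fin.ext h'.symm)
      · simp
  have s2 : ∑ j : Fin n, (if j.val + 1 = i.val then G i else 0) =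
      if i.val = 0 then 0 else G i := by
    by_cases h : i.val = 0
    · rw [if_pos h]
      exact Finset.sum_eq_zero fun j _ => if_neg (by omega)
    · rw [if_neg h, Finset.sum_eq_single (⟨i.val - 1, by omega⟩ : Fin n)]
      · exact if_pos (by simp; omega)
      · intro j _ hj
        exact if_neg fun h' => hj (Fin.ext (by simp; omega))
      · simp
  rw [s1, s2]
  have s3 : ∀ c : ℝ, ∑ j : Fin n, (if i.val = j.val then c else 0) = c := by
    intro c
    simp [← Fin.ext_iff]
  rw [s3]
  by_cases h : i.val = 0
  · have h5 : ¬ (0 + 1 = n) := by omega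
    simp only [h, h5, if_true, if_false]
    ring
  · by_cases h5 : i.val + 1 = n
    · have : n + 1 = i.val + 2 := by omega
      simp only [h, h5, if_true, if_false, this]
      ring
    · simp only [h, h5, if_false]
      ring

theorem innerVec_dotProduct_mulVec {n : ℕ} (hn : 2 ≤ n) (w : ℝ) (H G : ℕ → ℝ) :
    innerVec n H ⬝ᵥ (loopedPathMatrix n w *ᵥ innerVec n G) =
      ∑ i : Fin n, H (i + 1) * (G i + G (i + 2)) + H 1 * (w * G 1 - G 0) +
        H n * (w * G n - G (n + 1)) := by
  rw [dotProduct, Finset.sum_congr rfl fun i _ => by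
    rw [loopedPathMatrix_mulVec_innerVec hn w G i, mul_add, mul_add], Finset.sum_add_distrib,
    Finset.sum_add_distrib]
  congr 1
  · congr 1
    rw [Finset.sum_eq_single (⟨0, pos_of_gt hn⟩ : Fin n)]
    · simp [innerVec]
    · intro j _ hj
      rw [if_neg fun h => hj (Fin.ext h), mul_zero]
    · simp
  · rw [Finset.sum_eq_single (⟨n - 1, Nat.sub_one_lt_of_lt hn⟩ : Fin n)]
    · have : n - 1 + 1 = n := by omega
      simp [innerVec, this]
    · intro j _ hj
      rw [if_neg fun h => hj (Fin.ext (by simp; omega)), mul_zero]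
    · simp

theorem loopedPathMatrix_rev (n : ℕ) (w : ℝ) (i j : Fin n) :
    loopedPathMatrix n w i.rev j.rev = loopedPathMatrix n w i j := by
  simp only [loopedPathMatrix, of_apply, Fin.val_rev, Fin.ext_iff]
  have h1 : (n - (i.val + 1) + 1 = n - (j.val + 1) ∨ n - (j.val + 1) + 1 = n - (i.val + 1)) ↔
      (i.val + 1 = j.val ∨ j.val + 1 = i.val) := by omega
  have h2 : (n - (i.val + 1) = n - (j.val + 1) ∧
      (n - (i.val + 1) = 0 ∨ n - (i.val + 1) + 1 = n)) ↔
      (i.val = j.val ∧ (i.val = 0 ∨ i.val + 1 = n)) := by omega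
  simp only [h1, h2]

theorem loopedPathMatrix_mulVec_rev {n : ℕ} (w : ℝ) (f : Fin n → ℝ) (i : Fin n) :
    (loopedPathMatrix n w *ᵥ f) i.rev = (loopedPathMatrix n w *ᵥ fun j => f j.rev) i := by
  simp only [mulVec, dotProduct]
  rw [← Equiv.sum_comp Fin.revPerm]
  exact Finset.sum_congr rfl fun j _ => by
    rw [Fin.revPerm_apply, loopedPathMatrix_rev]

theorem dotProduct_eq_zero_of_parity {n : ℕ} {f g : Fin n → ℝ} (hf : ∀ i, f i.rev = f i)
    (hg : ∀ i, g i.rev = -g i) : f ⬝ᵥ g = 0 := by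
  have h : f ⬝ᵥ g = -(f ⬝ᵥ g) := by
    conv_lhs => rw [dotProduct, ← Equiv.sum_comp Fin.revPerm]
    rw [dotProduct, ← Finset.sum_neg_distrib]
    exact Finset.sum_congr rfl fun i _ => by rw [Fin.revPerm_apply, hf, hg, mul_neg]
  linarith

theorem innerVec_rev {n : ℕ} {G : ℕ → ℝ} {ρ : ℝ} (hG : ∀ k ≤ n + 1, G (n + 1 - k) = ρ * G k)
    (i : Fin n) : innerVec n G i.rev = ρ * innerVec n G i := by
  rw [innerVec, innerVec, ← hG (i + 1) (by omega), Fin.val_rev]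
  congr 1
  omega

/-- The sequence `q ^ k + ρ q ^ (n + 1 - k)`. -/
noncomputable def geomSeq (n : ℕ) (q ρ : ℝ) (k : ℕ) : ℝ := q ^ k + ρ * q ^ (n + 1 - k)

theorem geomSeq_recurrence {n : ℕ} {q : ℝ} (ρ : ℝ) (hq : q ≠ 0) {i : ℕ} (hi : i < n) :
    geomSeq n q ρ i + geomSeq n q ρ (i + 2) = (q + 1 / q) * geomSeq n q ρ (i + 1) := by
  obtain ⟨m, rfl⟩ : ∃ m, n = i + 1 + m := ⟨n - (i + 1), by omega⟩
  simp only [geomSeq, show i + 1 + m + 1 - i = m + 2 by omega,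
    show i + 1 + m + 1 - (i + 1) = m + 1 by omega, show i + 1 + m + 1 - (i + 2) = m by omega]
  field_simp
  ring

theorem geomSeq_rev {n : ℕ} {q ρ : ℝ} (hρ : ρ ^ 2 = 1) (k : ℕ) (hk : k ≤ n + 1) :
    geomSeq n q ρ (n + 1 - k) = ρ * geomSeq n q ρ k := by
  simp only [geomSeq, show n + 1 - (n + 1 - k) = k by omega]
  linear_combination (-q ^ (n + 1 - k)) * hρ

/-- A test vector built from a sequence that is symmetric or antisymmetric. -/
theorem innerVec_quadratic_of_parity {n : ℕ} (hn : 2 ≤ n) (w : ℝ) {G : ℕ → ℝ} {ρ : ℝ}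
    (hρ : ρ ^ 2 = 1) (hG : ∀ k ≤ n + 1, G (n + 1 - k) = ρ * G k) :
    innerVec n G ⬝ᵥ (loopedPathMatrix n w *ᵥ innerVec n G) =
      ∑ i : Fin n, G (i + 1) * (G i + G (i + 2)) + 2 * (G 1 * (w * G 1 - G 0)) := by
  rw [innerVec_dotProduct_mulVec hn]
  have h1 : G n = ρ * G 1 := by rw [← hG 1 (by omega)]; rfl
  have h0 : G (n + 1) = ρ * G 0 := by rw [← hG 0 (by omega)]; rfl
  rw [h0, h1]
  linear_combination (G 1 * (w * G 1 - G 0)) * hρ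

/-- For a solution of the recurrence, only the sign of the boundary term decides whether the
Rayleigh quotient exceeds y. All test vectors except the split one are handled this way. -/
theorem innerVec_quadratic_of_recurrence {n : ℕ} (hn : 2 ≤ n) (w : ℝ) {G : ℕ → ℝ} {ρ y : ℝ}
    (hρ : ρ ^ 2 = 1) (hG : ∀ k ≤ n + 1, G (n + 1 - k) = ρ * G k)
    (hrec : ∀ i < n, G i + G (i + 2) = y * G (i + 1)) :
    innerVec n G ⬝ᵥ (loopedPathMatrix n w *ᵥ innerVec n G) =
      y * (innerVec n G ⬝ᵥ innerVec n G) + 2 * (G 1 * (w * G 1 - G 0)) := by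
  rw [innerVec_quadratic_of_parity hn w hρ hG, dotProduct, Finset.mul_sum]
  congr 1
  refine Finset.sum_congr rfl fun i _ => ?_
  rw [hrec i i.2, innerVec]
  ring

theorem dotProduct_self_pos_of_ne_zero {n : ℕ} {f : Fin n → ℝ} (i : Fin n) (hf : f i ≠ 0) :
    0 < f ⬝ᵥ f := by
  rw [dotProduct]
  exact Finset.sum_pos' (fun j _ => mul_self_nonneg _)
    ⟨i, Finset.mem_univ _, mul_self_pos.mpr hf⟩

/-! ### Lower bounds for λ₁ and λ₂ from test vectors -/

section Eigenvalues

variable {n : ℕ} {w : ℝ}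

/-- With ratio w the boundary defect w G 1 - G 0 equals w² - 1 > 0. -/
theorem symmetric_test_vector (hn : 2 ≤ n) (hw : 1 < w) :
    0 < innerVec n (geomSeq n w 1) ⬝ᵥ innerVec n (geomSeq n w 1) ∧
    (w + 1 / w) * (innerVec n (geomSeq n w 1) ⬝ᵥ innerVec n (geomSeq n w 1)) ≤
      innerVec n (geomSeq n w 1) ⬝ᵥ (loopedPathMatrix n w *ᵥ innerVec n (geomSeq n w 1)) := by
  have hw0 : 0 < w := by linarith
  constructor
  · refine dotProduct_self_pos_of_ne_zero ⟨0, pos_of_gt hn⟩ (ne_of_gt ?_)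
    simp only [innerVec, geomSeq]
    positivity
  · rw [innerVec_quadratic_of_recurrence hn w (by norm_num) (geomSeq_rev (by norm_num))
      fun i hi => geomSeq_recurrence 1 hw0.ne' hi]
    have h1 : 0 < geomSeq n w 1 1 := by
      simp only [geomSeq]
      positivity
    have h0 : w * geomSeq n w 1 1 - geomSeq n w 1 0 = w ^ 2 - 1 := by
      simp only [geomSeq, Nat.add_sub_cancel, Nat.sub_zero]
      ring
    rw [h0]
    nlinarith [mul_pos h1 (show 0 < w ^ 2 - 1 by nlinarith)]

theorem loopedPathEigenvalue_antitone : Antitone (loopedPathEigenvalue n w) := fun _ _ h =>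
  (loopedPathMatrix_isHermitian n w).eigenvalues₀_antitone h

theorem le_loopedPathEigenvalue_zero (hn : 2 ≤ n) (hw : 1 < w) :
    w + 1 / w ≤ loopedPathEigenvalue n w ⟨0, pos_of_gt hn⟩ := by
  obtain ⟨V, hV, hA⟩ := exists_orthogonal_diagonalization (loopedPathMatrix_isHermitian n w)
  obtain ⟨h1, h2⟩ := symmetric_test_vector hn hw
  exact le_first_eigenvalue (l := loopedPathEigenvalue n w) hV hA
    (fun k => loopedPathEigenvalue_antitone (Nat.zero_le _)) h1 h2

/-- The antisymmetric test vector is paired with the symmetric one of ratio w; opposite parities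
make them orthogonal and conjugate for A. The cap y ≤ w + 1/w keeps the symmetric vector admissible.
-/
theorem le_loopedPathEigenvalue_one (hn : 2 ≤ n) (hw : 1 < w) {G : ℕ → ℝ} {y : ℝ}
    (hG : ∀ k ≤ n + 1, G (n + 1 - k) = -1 * G k) (hG0 : G 1 ≠ 0) (hy : y ≤ w + 1 / w)
    (hyG : y * (innerVec n G ⬝ᵥ innerVec n G) ≤
      innerVec n G ⬝ᵥ (loopedPathMatrix n w *ᵥ innerVec n G)) :
    y ≤ loopedPathEigenvalue n w ⟨1, hn⟩ := by
  obtain ⟨V, hV, hA⟩ := exists_orthogonal_diagonalization (loopedPathMatrix_isHermitian n w)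
  obtain ⟨h1, h2⟩ := symmetric_test_vector hn hw
  have hf : ∀ i, innerVec n (geomSeq n w 1) i.rev = innerVec n (geomSeq n w 1) i := fun i => by
    simpa using innerVec_rev (geomSeq_rev (n := n) (q := w) (ρ := 1) (by norm_num)) i
  have hg : ∀ i, innerVec n G i.rev = -innerVec n G i := fun i => by
    simpa using innerVec_rev hG i
  have hAf : ∀ i, (loopedPathMatrix n w *ᵥ innerVec n (geomSeq n w 1)) i.rev =
      (loopedPathMatrix n w *ᵥ innerVec n (geomSeq n w 1)) i := fun i => by
    rw [loopedPathMatrix_mulVec_rev]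
    simp only [hf]
  have hAg : ∀ i, (loopedPathMatrix n w *ᵥ innerVec n G) i.rev =
      -(loopedPathMatrix n w *ᵥ innerVec n G) i := fun i => by
    rw [loopedPathMatrix_mulVec_rev]
    simp only [hg]
    exact congrFun (mulVec_neg _ _) i
  refine le_second_eigenvalue (l := loopedPathEigenvalue n w) (i₀ := ⟨0, pos_of_gt hn⟩) hV hA ?_ h1
    (dotProduct_self_pos_of_ne_zero (f := innerVec n G) ⟨0, pos_of_gt hn⟩ hG0)
    (dotProduct_eq_zero_of_parity hf hg) (dotProduct_eq_zero_of_parity hf hAg)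
    (by rw [dotProduct_comm]; exact dotProduct_eq_zero_of_parity hAf hg)
    ((mul_le_mul_of_nonneg_right hy h1.le).trans h2) hyG
  intro k hk
  refine loopedPathEigenvalue_antitone (Fin.mk_le_of_le_val ?_)
  by_contra h
  exact hk (Fin.ext (by simp; omega))

end Eigenvalues

/-! ### Shape of the eigenvectors -/

section Eigenvectors

variable {n : ℕ} {w lam : ℝ}

/-- An eigenvector of `A(w)` extends to a solution of a two-term recurrence with reflecting
boundary values. -/
theorem exists_sequence_of_eigenvector (hn : 2 ≤ n) {f : Fin n → ℝ}
    (hf : loopedPathMatrix n w *ᵥ f = lam • f) :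
    ∃ G : ℕ → ℝ, f = innerVec n G ∧ G 0 = w * G 1 ∧ G (n + 1) = w * G n ∧
      ∀ i < n, G i + G (i + 2) = lam * G (i + 1) := by
  -- Indices shift by one, and the values beyond the ends are chosen to make both boundary defects
  -- vanish.
  let G : ℕ → ℝ := fun k => if k = 0 then w * f ⟨0, pos_of_gt hn⟩ else
    if h : k - 1 < n then f ⟨k - 1, h⟩ else w * f ⟨n - 1, Nat.sub_one_lt_of_lt hn⟩
  have hfG : f = innerVec n G := by
    funext i
    simp [innerVec, G]
  have h0 : G 0 = w * G 1 := by simp [G, show 0 < n by omega]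
  have h1 : G (n + 1) = w * G n := by
    simp [G, show n ≠ 0 by omega, show n - 1 < n by omega]
  refine ⟨G, hfG, h0, h1, fun i hi => ?_⟩
  have := congrFun hf ⟨i, hi⟩
  rw [hfG, loopedPathMatrix_mulVec_innerVec hn] at this
  simpa [h0, h1, innerVec] using this

theorem sequence_eq_zero {G : ℕ → ℝ} (h0 : G 0 = w * G 1)
    (hrec : ∀ i < n, G i + G (i + 2) = lam * G (i + 1)) (h1 : G 1 = 0) :
    ∀ k ≤ n, G k = 0 ∧ G (k + 1) = 0 := by
  intro k
  induction k with
  | zero => intro _; exact ⟨by rw [h0, h1, mul_zero], h1⟩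
  | succ k ih =>
    intro hk
    obtain ⟨ha, hb⟩ := ih (by omega)
    refine ⟨hb, ?_⟩
    have := hrec k (by omega)
    rw [ha, hb] at this
    simpa using this

/-- The reversed sequence solves the same recurrence with the same boundary condition, so it is
proportional to the original. Two consecutive indices are carried because the recurrence has order
two. -/
theorem sequence_reflection {G : ℕ → ℝ} (h0 : G 0 = w * G 1) (hn1 : G (n + 1) = w * G n)
    (hrec : ∀ i < n, G i + G (i + 2) = lam * G (i + 1)) :
    ∀ k ≤ n, G (n + 1 - k) * G 1 = G n * G k ∧ G (n - k) * G 1 = G n * G (k + 1) := by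
  intro k
  induction k with
  | zero =>
    intro _
    refine ⟨?_, rfl⟩
    rw [Nat.sub_zero, hn1, h0]
    ring
  | succ k ih =>
    intro hk
    obtain ⟨ha, hb⟩ := ih (by omega)
    refine ⟨by rw [show n + 1 - (k + 1) = n - k by omega]; exact hb, ?_⟩
    have h1 := hrec k (by omega)
    have h2 := hrec (n - (k + 1)) (by omega)
    rw [show n - (k + 1) + 2 = n + 1 - k by omega, show n - (k + 1) + 1 = n - k by omega] at h2
    linear_combination G 1 * h2 - G n * h1 + lam * hb - ha

theorem exists_parity {G : ℕ → ℝ} (h0 : G 0 = w * G 1)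
    (hn1 : G (n + 1) = w * G n) (hrec : ∀ i < n, G i + G (i + 2) = lam * G (i + 1))
    (hG1 : G 1 ≠ 0) :
    ∃ ρ : ℝ, (ρ = 1 ∨ ρ = -1) ∧ ∀ k ≤ n + 1, G (n + 1 - k) = ρ * G k := by
  have href : ∀ k ≤ n + 1, G (n + 1 - k) * G 1 = G n * G k := by
    intro k hk
    rcases Nat.lt_or_ge n k with h | h
    · obtain rfl : k = n + 1 := by omega
      have := (sequence_reflection h0 hn1 hrec n le_rfl).2
      rw [← this]
      simp
    · exact (sequence_reflection h0 hn1 hrec k h).1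
  refine ⟨G n / G 1, ?_, fun k hk => ?_⟩
  · have h := href n (by omega)
    rw [show n + 1 - n = 1 by omega] at h
    have : (G n / G 1) ^ 2 = 1 := by
      field_simp
      linarith
    exact (sq_eq_sq_iff_eq_or_eq_neg.mp (this.trans (one_pow 2).symm))
  · rw [div_mul_eq_mul_div, eq_div_iff hG1, href k hk]

theorem sequence_eq_geomSeq {G : ℕ → ℝ} {q ρ : ℝ} (hn : 2 ≤ n) (hq : 1 < q)
    (hρ : ∀ k ≤ n + 1, G (n + 1 - k) = ρ * G k)
    (hrec : ∀ i < n, G i + G (i + 2) = (q + 1 / q) * G (i + 1)) :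
    ∃ P : ℝ, ∀ k ≤ n + 1, G k = P * geomSeq n q ρ k := by
  have hq0 : q ≠ 0 := by positivity
  have hq2 : q ^ 2 - 1 ≠ 0 := by nlinarith
  -- The general solution is P q^k + R q^(-k); P and R are fitted to k = 0 and k = 1, and
  -- multiplying by q^k below avoids negative powers.
  set P := (q * G 1 - G 0) / (q ^ 2 - 1) with hP
  set R := (q ^ 2 * G 0 - q * G 1) / (q ^ 2 - 1) with hR
  have hform : ∀ k ≤ n, G k * q ^ k = P * q ^ (2 * k) + R ∧
      G (k + 1) * q ^ (k + 1) = P * q ^ (2 * (k + 1)) + R := by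
    intro k
    induction k with
    | zero =>
      intro _
      constructor
      · rw [hP, hR]
        field_simp
        ring
      · rw [hP, hR]
        field_simp
        ring
    | succ k ih =>
      intro hk
      obtain ⟨ha, hb⟩ := ih (by omega)
      refine ⟨hb, ?_⟩
      have h := hrec k (by omega)
      field_simp at h
      have e1 : q ^ (2 * (k + 1 + 1)) = q ^ (2 * k) * q ^ 4 := by ring
      have e2 : q ^ (2 * (k + 1)) = q ^ (2 * k) * q ^ 2 := by ring
      have e3 : q ^ (k + 1 + 1) = q ^ k * q ^ 2 := by ring
      have e4 : q ^ (k + 1) = q ^ k * q := by ring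
      rw [e2, e4] at hb
      rw [e1, e3]
      linear_combination q ^ k * q * h - q ^ 2 * ha + (q ^ 2 + 1) * hb
  have hall : ∀ k ≤ n + 1, G k * q ^ k = P * q ^ (2 * k) + R := by
    intro k hk
    rcases Nat.lt_or_ge n k with h | h
    · obtain rfl : k = n + 1 := by omega
      exact (hform n le_rfl).2
    · exact (hform k h).1
  have hRP : R = ρ * P * q ^ (n + 1) := by
    have a0 := hall 0 (by omega)
    have a1 := hall 1 (by omega)
    have b0 := hall (n + 1) le_rfl
    have b1 := hall n (by omega)
    have c0 : G (n + 1) = ρ * G 0 := hρ 0 (by omega)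
    have c1 : G n = ρ * G 1 := hρ 1 (by omega)
    have e1 : q ^ (2 * (n + 1)) = q ^ (2 * n) * q ^ 2 := by ring
    have e4 : q ^ (n + 1) = q ^ n * q := by ring
    rw [c0, e1, e4] at b0
    rw [c1] at b1
    rw [e4]
    simp only [pow_zero, mul_one, pow_one, mul_zero] at a0 a1
    refine mul_left_cancel₀ hq2 ?_
    linear_combination b0 - q ^ 2 * b1 - ρ * q ^ n * q * a0 + ρ * q ^ n * q * a1
  refine ⟨P, fun k hk => ?_⟩
  refine mul_right_cancel₀ (pow_ne_zero k hq0) ?_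
  rw [hall k hk, hRP, geomSeq]
  have e : q ^ (n + 1) = q ^ (n + 1 - k) * q ^ k := by
    rw [← pow_add]
    congr 1
    omega
  rw [e]
  ring

/-- Structure of the eigenvectors with eigenvalue `q + 1 / q > 2`. -/
theorem eigenvector_eq_geomSeq (hn : 2 ≤ n) {f : Fin n → ℝ} {q : ℝ} (hq : 1 < q)
    (hf : loopedPathMatrix n w *ᵥ f = (q + 1 / q) • f) (hf0 : f ≠ 0) :
    ∃ ρ P : ℝ, (ρ = 1 ∨ ρ = -1) ∧ P ≠ 0 ∧ f = P • innerVec n (geomSeq n q ρ) ∧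
      geomSeq n q ρ 0 = w * geomSeq n q ρ 1 := by
  obtain ⟨G, hfG, h0, hn1, hrec⟩ := exists_sequence_of_eigenvector hn hf
  have hG1 : G 1 ≠ 0 := by
    intro h
    refine hf0 ?_
    rw [hfG]
    funext i
    exact (sequence_eq_zero h0 hrec h i i.2.le).2
  obtain ⟨ρ, hρ, hpar⟩ := exists_parity h0 hn1 hrec hG1
  obtain ⟨P, hP⟩ := sequence_eq_geomSeq hn hq hpar hrec
  have hP0 : P ≠ 0 := by
    rintro rfl
    exact hG1 (by rw [hP 1 (by omega), zero_mul])
  refine ⟨ρ, P, hρ, hP0, ?_, ?_⟩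
  · rw [hfG]
    funext i
    exact hP (i + 1) (by omega)
  · rw [hP 0 (by omega), hP 1 (by omega)] at h0
    refine mul_left_cancel₀ hP0 ?_
    linarith

/-- Eigenvectors are symmetric or antisymmetric. -/
theorem eigenvector_parity (hn : 2 ≤ n) {f : Fin n → ℝ}
    (hf : loopedPathMatrix n w *ᵥ f = lam • f) (hf0 : f ≠ 0) :
    ∃ ρ : ℝ, (ρ = 1 ∨ ρ = -1) ∧ ∀ i, f i.rev = ρ * f i := by
  obtain ⟨G, hfG, h0, hn1, hrec⟩ := exists_sequence_of_eigenvector hn hf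
  have hG1 : G 1 ≠ 0 := by
    intro h
    refine hf0 ?_
    rw [hfG]
    funext i
    exact (sequence_eq_zero h0 hrec h i i.2.le).2
  obtain ⟨ρ, hρ, hpar⟩ := exists_parity h0 hn1 hrec hG1
  exact ⟨ρ, hρ, fun i => by rw [hfG]; exact innerVec_rev hpar i⟩

/-- For equal parity the entries have matching signs at every vertex, so two such vectors are never
orthogonal. This rules out a symmetric second eigenvector. -/
theorem geomSeq_dotProduct_pos (hn : 2 ≤ n) {q r ρ : ℝ} (hq : 1 < q) (hr : 1 < r)
    (hρ : ρ = 1 ∨ ρ = -1) :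
    0 < innerVec n (geomSeq n q ρ) ⬝ᵥ innerVec n (geomSeq n r ρ) := by
  have hq0 : 0 < q := by linarith
  have hr0 : 0 < r := by linarith
  rw [dotProduct]
  rcases hρ with rfl | rfl
  · refine Finset.sum_pos (fun i _ => ?_) ⟨⟨0, pos_of_gt hn⟩, Finset.mem_univ _⟩
    simp only [innerVec, geomSeq]
    positivity
  · refine Finset.sum_pos' (fun i _ => ?_) ⟨⟨0, pos_of_gt hn⟩, Finset.mem_univ _, ?_⟩
    · simp only [innerVec, geomSeq]
      rcases le_total (i.val + 1) (n + 1 - (i.val + 1)) with h | h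
      · refine mul_nonneg_of_nonpos_of_nonpos ?_ ?_
        · linarith [pow_le_pow_right₀ hq.le h]
        · linarith [pow_le_pow_right₀ hr.le h]
      · refine mul_nonneg ?_ ?_
        · linarith [pow_le_pow_right₀ hq.le h]
        · linarith [pow_le_pow_right₀ hr.le h]
    · simp only [innerVec, geomSeq]
      have h : 0 + 1 < n + 1 - (0 + 1) := by omega
      refine mul_pos_of_neg_of_neg ?_ ?_
      · linarith [pow_lt_pow_right₀ hq h]
      · linarith [pow_lt_pow_right₀ hr h]

/-- The boundary condition reads q^n (w - q) = w q - 1, and the right side is positive. -/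
theorem geomSeq_boundary_lt {q : ℝ} (hw : 1 < w) (hq : 1 < q)
    (h : geomSeq n q (-1) 0 = w * geomSeq n q (-1) 1) : q < w := by
  simp only [geomSeq, Nat.sub_zero, Nat.add_sub_cancel, pow_zero, pow_succ] at h
  have hqn : 0 < q ^ n := by positivity
  by_contra hle
  rw [not_lt] at hle
  nlinarith [mul_nonneg hqn.le (sub_nonneg.mpr hle), mul_pos (sub_pos.mpr hw) (sub_pos.mpr hq)]

theorem exists_eq_add_inv {x : ℝ} (hx : 2 < x) : ∃ q : ℝ, 1 < q ∧ x = q + 1 / q := by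
  have hs : 0 < √(x ^ 2 - 4) := Real.sqrt_pos.mpr (by nlinarith)
  have hs2 : √(x ^ 2 - 4) ^ 2 = x ^ 2 - 4 := Real.sq_sqrt (by nlinarith)
  refine ⟨(x + √(x ^ 2 - 4)) / 2, by linarith, ?_⟩
  field_simp
  nlinarith

/-- The sum of squares of the symmetric or antisymmetric geometric vector. -/
theorem geomSeq_dotProduct_self {q ρ : ℝ} (hq : 1 < q) (hρ : ρ ^ 2 = 1) :
    innerVec n (geomSeq n q ρ) ⬝ᵥ innerVec n (geomSeq n q ρ) =
      2 * q ^ 2 * (q ^ (2 * n) - 1) / (q ^ 2 - 1) + 2 * ρ * n * q ^ (n + 1) := by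
  have hq2 : q ^ 2 - 1 ≠ 0 := by nlinarith
  have hterm : ∀ i ∈ Finset.range n, geomSeq n q ρ (i + 1) * geomSeq n q ρ (i + 1) =
      q ^ 2 * (q ^ 2) ^ i + q ^ 2 * (q ^ 2) ^ (n - 1 - i) + 2 * ρ * q ^ (n + 1) := by
    intro i hi
    obtain ⟨m, rfl⟩ : ∃ m, n = i + 1 + m := ⟨n - (i + 1), by simp at hi; omega⟩
    simp only [geomSeq, show i + 1 + m + 1 - (i + 1) = m + 1 by omega,
      show i + 1 + m - 1 - i = m by omega]
    linear_combination (q ^ (m + 1)) ^ 2 * hρ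
  have hgeom : ∑ i ∈ Finset.range n, (q ^ 2) ^ i = (q ^ (2 * n) - 1) / (q ^ 2 - 1) := by
    rw [geom_sum_eq (by intro h; exact hq2 (by rw [h, sub_self])), pow_mul]
  have hsum : innerVec n (geomSeq n q ρ) ⬝ᵥ innerVec n (geomSeq n q ρ) =
      ∑ i ∈ Finset.range n, geomSeq n q ρ (i + 1) * geomSeq n q ρ (i + 1) := by
    rw [dotProduct, Finset.sum_range]
    rfl
  rw [hsum, Finset.sum_congr rfl hterm, Finset.sum_add_distrib, Finset.sum_add_distrib,
    ← Finset.mul_sum, ← Finset.mul_sum, Finset.sum_range_reflect (fun i => (q ^ 2) ^ i), hgeom,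
    Finset.sum_const, Finset.card_range, nsmul_eq_mul]
  ring

end Eigenvectors

/-! ### Squared norm against end entry -/

theorem one_add_mul_add_le_pow {z : ℝ} (hz : 0 ≤ z) (k : ℕ) :
    1 + k * z + k * (k - 1) / 2 * z ^ 2 ≤ (1 + z) ^ k := by
  induction k with
  | zero => simp
  | succ k ih =>
    have h : (0 : ℝ) ≤ k * (k - 1) := by
      rcases k with _ | k
      · simp
      · push_cast
        have : (0 : ℝ) ≤ k := k.cast_nonneg
        nlinarith
    have := mul_le_mul_of_nonneg_right ih (show 0 ≤ 1 + z by linarith)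
    rw [pow_succ (1 + z) k]
    push_cast
    nlinarith [mul_nonneg h (pow_nonneg hz 3)]

/-- Second-order Bernoulli inequality for a power of q² = 1 + (q² - 1). This growth lets the
constant 16 in b absorb the cross terms of the symmetric vector. -/
theorem mul_sq_le_pow {q : ℝ} (hq : 1 < q) (N : ℕ) :
    (N : ℝ) * (N - 1) * (q ^ 2 - 1) ^ 2 ≤ 8 * (q ^ 2 * q ^ N) := by
  obtain ⟨M, hM⟩ : ∃ M, M = N / 2 := ⟨_, rfl⟩
  have hz : 0 ≤ q ^ 2 - 1 := by nlinarith
  have h1 := one_add_mul_add_le_pow hz (M + 1)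
  have h2 : (1 + (q ^ 2 - 1)) ^ (M + 1) ≤ q ^ 2 * q ^ N := by
    rw [add_sub_cancel, ← pow_mul, ← pow_add]
    exact pow_le_pow_right₀ hq.le (by omega)
  have h3 : (N : ℝ) * (N - 1) ≤ 4 * (M * (M + 1)) := by
    rcases N with _ | N
    · simp
      positivity
    · have : (N + 1) * N ≤ 4 * (M * (M + 1)) := by
        have h : N ≤ 2 * M := by omega
        nlinarith
      have := (Nat.cast_le (α := ℝ)).mpr this
      push_cast at this ⊢
      linarith
  have h4 := mul_le_mul_of_nonneg_right h3 (sq_nonneg (q ^ 2 - 1))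
  push_cast at h1
  nlinarith [mul_nonneg (show (0 : ℝ) ≤ M + 1 by positivity) hz]

theorem symmetric_sum_sq_le {n : ℕ} (hn : 2 ≤ n) {q : ℝ} (hq : 1 < q) :
    innerVec n (geomSeq n q 1) ⬝ᵥ innerVec n (geomSeq n q 1) ≤ geomSeq n q 1 1 ^ 2 *
      (2 * q ^ 2 / (q ^ 2 - 1) + 16 * q ^ 2 / ((n - 1) * (q ^ 2 - 1) ^ 2)) := by
  rw [geomSeq_dotProduct_self hq (by norm_num)]
  obtain ⟨N, rfl⟩ : ∃ N, n = N + 1 := ⟨n - 1, by omega⟩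
  have hz : 0 < q ^ 2 - 1 := by nlinarith
  have hN : (0 : ℝ) < N := by
    have : 0 < N := by omega
    exact_mod_cast this
  have hE : 0 < q ^ N := by positivity
  have hkey := mul_sq_le_pow hq N
  have e1 : q ^ (2 * (N + 1)) = q ^ 2 * (q ^ N) ^ 2 := by ring
  have e2 : q ^ (N + 1 + 1) = q ^ 2 * q ^ N := by ring
  have e3 : geomSeq (N + 1) q 1 1 = q * (1 + q ^ N) := by
    simp only [geomSeq, Nat.add_sub_cancel]
    ring
  rw [e1, e2, e3]
  push_cast
  set E := q ^ N with hEdef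
  rw [add_sub_cancel_right]
  -- In this exact form of the difference, only the last summand has no evident sign, and
  -- `mul_sq_le_pow` settles it.
  have hdiff : (q * (1 + E)) ^ 2 * (2 * q ^ 2 / (q ^ 2 - 1) + 16 * q ^ 2 / (N * (q ^ 2 - 1) ^ 2)) -
      (2 * q ^ 2 * (q ^ 2 * E ^ 2 - 1) / (q ^ 2 - 1) + 2 * 1 * (N + 1) * (q ^ 2 * E)) =
      2 * q ^ 2 / (N * (q ^ 2 - 1) ^ 2) * (N * (q ^ 2 - 1) * (q ^ 2 + 1 + 2 * E) +
        8 * q ^ 2 * (1 + 2 * E) + E * (8 * (q ^ 2 * E) - N * (N - 1) * (q ^ 2 - 1) ^ 2)) := by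
    field_simp
    ring
  rw [← sub_nonneg, hdiff]
  have : 0 ≤ E * (8 * (q ^ 2 * E) - N * (N - 1) * (q ^ 2 - 1) ^ 2) :=
    mul_nonneg hE.le (by linarith)
  positivity

theorem two_mul_pow_le {q : ℝ} (hq : 1 < q) (N : ℕ) :
    2 * q ^ (N + 1) ≤ q ^ 2 + 1 + N * (q ^ 2 - 1) * q ^ (N + 1) := by
  induction N with
  | zero => norm_num; nlinarith [sq_nonneg (q - 1)]
  | succ N ih =>
    have hE : 1 ≤ q ^ N := one_le_pow₀ hq.le
    have h := mul_le_mul_of_nonneg_left ih (show 0 ≤ q by linarith)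
    rw [pow_succ q (N + 1), pow_succ q N] at *
    push_cast
    have h2 : q ^ 2 + 1 ≤ (q + 1) * (q ^ N * q * q) := by
      have : 1 * (q * q) ≤ q ^ N * (q * q) := mul_le_mul_of_nonneg_right hE (by positivity)
      nlinarith
    nlinarith [mul_le_mul_of_nonneg_left h2 (show 0 ≤ q - 1 by linarith)]

theorem antisymmetric_sum_sq_le {n : ℕ} (hn : 2 ≤ n) {q : ℝ} (hq : 1 < q) :
    innerVec n (geomSeq n q (-1)) ⬝ᵥ innerVec n (geomSeq n q (-1)) ≤ geomSeq n q (-1) 1 ^ 2 *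
      (2 * q ^ 2 / (q ^ 2 - 1)) := by
  rw [geomSeq_dotProduct_self hq (by norm_num)]
  obtain ⟨N, rfl⟩ : ∃ N, n = N + 1 + 1 := ⟨n - 2, by omega⟩
  have hz : 0 < q ^ 2 - 1 := by nlinarith
  have hkey := two_mul_pow_le hq N
  have e1 : q ^ (2 * (N + 1 + 1)) = q ^ 2 * (q ^ (N + 1)) ^ 2 := by ring
  have e2 : q ^ (N + 1 + 1 + 1) = q ^ 2 * q ^ (N + 1) := by ring
  have e3 : geomSeq (N + 1 + 1) q (-1) 1 = q * (1 - q ^ (N + 1)) := by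
    simp only [geomSeq, Nat.add_sub_cancel]
    ring
  rw [e1, e2, e3]
  push_cast
  set E := q ^ (N + 1) with hEdef
  have hdiff : (q * (1 - E)) ^ 2 * (2 * q ^ 2 / (q ^ 2 - 1)) -
      (2 * q ^ 2 * (q ^ 2 * E ^ 2 - 1) / (q ^ 2 - 1) + 2 * (-1) * (N + 1 + 1) * (q ^ 2 * E)) =
      2 * q ^ 2 / (q ^ 2 - 1) * (q ^ 2 + 1 + N * (q ^ 2 - 1) * E - 2 * E) := by
    field_simp
    ring
  rw [← sub_nonneg, hdiff]
  have : 0 ≤ q ^ 2 + 1 + N * (q ^ 2 - 1) * E - 2 * E := by linarith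
  positivity

/-! ### The function b in the variable q, and its monotonicity -/

theorem sqrt_sq_sub_four {q : ℝ} (hq : 1 < q) : √((q + 1 / q) ^ 2 - 4) = (q ^ 2 - 1) / q := by
  have hq0 : 0 < q := by linarith
  rw [show (q + 1 / q) ^ 2 - 4 = ((q ^ 2 - 1) / q) ^ 2 by field_simp; ring]
  exact Real.sqrt_sq (div_nonneg (by nlinarith) hq0.le)

theorem bFun_add_inv (n : ℕ) {q : ℝ} (hq : 1 < q) :
    bFun n (q + 1 / q) =
      (2 * q ^ 2 / (q ^ 2 - 1) + 16 * q ^ 2 / ((n - 1) * (q ^ 2 - 1) ^ 2))⁻¹ := by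
  have hq0 : 0 < q := by linarith
  have hz : q ^ 2 - 1 ≠ 0 := by nlinarith
  have h4 : (q + 1 / q) ^ 2 - 4 = ((q ^ 2 - 1) / q) ^ 2 := by field_simp; ring
  rw [bFun, sqrt_sq_sub_four hq, h4]
  congr 2
  · field_simp
    ring
  · rw [div_pow, ← mul_div_assoc, div_div_eq_mul_div]

/-- A form of `bFun` that is visibly monotone. -/
theorem bFun_eq {n : ℕ} {x : ℝ} (hx : 2 < x) :
    bFun n x = (1 + √(1 + 4 / (x ^ 2 - 4)) + 16 / (((n : ℝ) - 1) * (x ^ 2 - 4)))⁻¹ := by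
  have hX : 0 < x ^ 2 - 4 := by nlinarith
  have hs : 0 < √(x ^ 2 - 4) := Real.sqrt_pos.mpr hX
  rw [bFun, add_div, div_self hs.ne', add_comm (x / _) 1]
  congr 3
  rw [show 1 + 4 / (x ^ 2 - 4) = x ^ 2 / (x ^ 2 - 4) by field_simp; ring,
    Real.sqrt_div (sq_nonneg x), Real.sqrt_sq (by linarith)]

theorem bFun_mono {n : ℕ} (hn : 2 ≤ n) {x y : ℝ} (hx : 2 < x) (hxy : x ≤ y) :
    bFun n x ≤ bFun n y := by
  have hX : 0 < x ^ 2 - 4 := by nlinarith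
  have hXY : x ^ 2 - 4 ≤ y ^ 2 - 4 := by nlinarith
  have hn' : (0 : ℝ) < n - 1 := by
    have : (2 : ℝ) ≤ n := by exact_mod_cast hn
    linarith
  have hY : 0 < y ^ 2 - 4 := by linarith
  rw [bFun_eq hx, bFun_eq (hx.trans_le hxy)]
  gcongr

theorem two_lt_add_inv {w : ℝ} (hw : 1 < w) : 2 < w + 1 / w := by
  have h : w - 1 ≠ 0 := by linarith
  have h1 : 0 < (w - 1) ^ 2 / w := by positivity
  have h2 : (w - 1) ^ 2 / w = w + 1 / w - 2 := by
    field_simp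
    ring
  linarith

/-! ### End entries of unit eigenvectors -/

section UnitEigenvectors

variable {n : ℕ} {w : ℝ} {f : Fin n → ℝ}

/-- The end entry of a symmetric unit eigenvector with eigenvalue `q + 1 / q` is bounded below. -/
theorem unit_symmetric_eigenvector_bound (hn : 2 ≤ n) {q P : ℝ} (hq : 1 < q)
    (hf : f = P • innerVec n (geomSeq n q 1)) (hunit : f ⬝ᵥ f = 1) :
    bFun n (q + 1 / q) ≤ f ⟨0, pos_of_gt hn⟩ ^ 2 := by
  have hS := symmetric_sum_sq_le hn hq
  have hn' : (0 : ℝ) < n - 1 := by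
    have : (2 : ℝ) ≤ n := by exact_mod_cast hn
    linarith
  have hz : 0 < q ^ 2 - 1 := by nlinarith
  rw [bFun_add_inv n hq, inv_le_iff_one_le_mul₀ (by positivity)]
  refine hunit.symm.trans_le ?_
  have h0 : f ⟨0, pos_of_gt hn⟩ = P * geomSeq n q 1 1 := by rw [hf]; rfl
  rw [h0, mul_pow, mul_assoc]
  conv_lhs => rw [hf]
  rw [smul_dotProduct, dotProduct_smul, smul_eq_mul, smul_eq_mul, ← mul_assoc, ← sq]
  exact mul_le_mul_of_nonneg_left hS (sq_nonneg _)

theorem unit_antisymmetric_eigenvector_bound (hn : 2 ≤ n) {q P : ℝ} (hq : 1 < q)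
    (hf : f = P • innerVec n (geomSeq n q (-1))) (hunit : f ⬝ᵥ f = 1) :
    (2 * q ^ 2 / (q ^ 2 - 1))⁻¹ ≤ f ⟨0, pos_of_gt hn⟩ ^ 2 := by
  have hS := antisymmetric_sum_sq_le hn hq
  have hz : 0 < q ^ 2 - 1 := by nlinarith
  rw [inv_le_iff_one_le_mul₀ (by positivity)]
  refine hunit.symm.trans_le ?_
  have h0 : f ⟨0, pos_of_gt hn⟩ = P * geomSeq n q (-1) 1 := by rw [hf]; rfl
  rw [h0, mul_pow, mul_assoc]
  conv_lhs => rw [hf]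
  rw [smul_dotProduct, dotProduct_smul, smul_eq_mul, smul_eq_mul, ← mul_assoc, ← sq]
  exact mul_le_mul_of_nonneg_left hS (sq_nonneg _)

end UnitEigenvectors

/-! ### Even n: the split test vector gives λ₂ ≥ w + 1/w - τ -/

section EvenOrder

/-- The antisymmetric test sequence on `2 h` inner points, geometric on each half. -/
noncomputable def splitSeq (h : ℕ) (w : ℝ) (k : ℕ) : ℝ :=
  if k ≤ h then w ^ (h - k) else -w ^ (k - h - 1)

variable {h : ℕ} {w : ℝ}

theorem splitSeq_rev (k : ℕ) (hk : k ≤ 2 * h + 1) :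
    splitSeq h w (2 * h + 1 - k) = -1 * splitSeq h w k := by
  by_cases hkh : k ≤ h
  · simp only [splitSeq, hkh, if_true, show ¬ (2 * h + 1 - k ≤ h) by omega, if_false,
      show 2 * h + 1 - k - h - 1 = h - k by omega]
    ring
  · simp only [splitSeq, hkh, if_false, show 2 * h + 1 - k ≤ h by omega, if_true,
      show h - (2 * h + 1 - k) = k - h - 1 by omega]
    ring

theorem splitSeq_dotProduct_self (hw : 1 < w) :
    innerVec (2 * h) (splitSeq h w) ⬝ᵥ innerVec (2 * h) (splitSeq h w) =
      2 * ((w ^ (2 * h) - 1) / (w ^ 2 - 1)) := by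
  have hsum : innerVec (2 * h) (splitSeq h w) ⬝ᵥ innerVec (2 * h) (splitSeq h w) =
      ∑ i ∈ Finset.range (2 * h), splitSeq h w (i + 1) * splitSeq h w (i + 1) := by
    rw [dotProduct, Finset.sum_range]
    rfl
  have hw2 : w ^ 2 ≠ 1 := by nlinarith
  have hgeom : ∑ i ∈ Finset.range h, (w ^ 2) ^ i = (w ^ (2 * h) - 1) / (w ^ 2 - 1) := by
    rw [geom_sum_eq hw2, pow_mul]
  rw [hsum, two_mul, Finset.sum_range_add, ← two_mul, ← hgeom, two_mul]
  congr 1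
  · rw [← Finset.sum_range_reflect]
    refine Finset.sum_congr rfl fun i hi => ?_
    rw [Finset.mem_range] at hi
    simp only [splitSeq, show h - 1 - i + 1 ≤ h by omega, if_true,
      show h - (h - 1 - i + 1) = i by omega]
    ring
  · refine Finset.sum_congr rfl fun i _ => ?_
    simp only [splitSeq, show ¬ (h + i + 1 ≤ h) by omega, if_false,
      show h + i + 1 - h - 1 = i by omega]
    ring

/-- The boundary defect vanishes and the recurrence with factor w + 1/w fails only at the two middle
vertices, where the neighbour across the middle is ∓1 instead of ±1/w. Each of them costs 1 + 1/w.
-/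
theorem splitSeq_quadratic (hh : 1 ≤ h) (hw : 1 < w) :
    innerVec (2 * h) (splitSeq h w) ⬝ᵥ
      (loopedPathMatrix (2 * h) w *ᵥ innerVec (2 * h) (splitSeq h w)) =
      (w + 1 / w) * (innerVec (2 * h) (splitSeq h w) ⬝ᵥ innerVec (2 * h) (splitSeq h w)) -
        2 * (1 + 1 / w) := by
  have hw0 : w ≠ 0 := by positivity
  rw [innerVec_quadratic_of_parity (by omega) w (by norm_num) splitSeq_rev]
  have h01 : w * splitSeq h w 1 - splitSeq h w 0 = 0 := by
    simp only [splitSeq, hh, zero_le, if_true, Nat.sub_zero]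
    rw [← pow_succ', Nat.sub_add_cancel hh, sub_self]
  have hterm : ∀ i : Fin (2 * h),
      splitSeq h w (i + 1) * (splitSeq h w i + splitSeq h w (i + 2)) =
      (w + 1 / w) * (innerVec (2 * h) (splitSeq h w) i * innerVec (2 * h) (splitSeq h w) i) -
        ((if i = ⟨h - 1, by omega⟩ then 1 + 1 / w else 0) +
          if i = ⟨h, by omega⟩ then 1 + 1 / w else 0) := by
    rintro ⟨i, hi⟩
    simp only [innerVec, Fin.mk.injEq]
    by_cases h1 : i + 2 ≤ h
    · obtain ⟨m, rfl⟩ : ∃ m, h = i + 2 + m := ⟨h - (i + 2), by omega⟩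
      simp only [splitSeq, show i + 1 ≤ i + 2 + m by omega, show i ≤ i + 2 + m by omega,
        show i + 2 ≤ i + 2 + m by omega, if_true, show ¬ (i = i + 2 + m - 1) by omega,
        show ¬ (i = i + 2 + m) by omega, if_false, show i + 2 + m - (i + 1) = m + 1 by omega,
        show i + 2 + m - i = m + 2 by omega, show i + 2 + m - (i + 2) = m by omega]
      field_simp
      ring
    · by_cases h2 : i + 1 = h
      · subst h2
        simp [splitSeq]
        ring
      · by_cases h3 : i = h
        · subst h3
          simp [splitSeq, show ¬ (i = i - 1) by omega]
          ring
        · obtain ⟨m, rfl⟩ : ∃ m, i = h + 1 + m := ⟨i - (h + 1), by omega⟩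
          simp only [splitSeq, show ¬ (h + 1 + m + 1 ≤ h) by omega,
            show ¬ (h + 1 + m ≤ h) by omega, show ¬ (h + 1 + m + 2 ≤ h) by omega, if_false,
            show ¬ (h + 1 + m = h - 1) by omega, show ¬ (h + 1 + m = h) by omega,
            show h + 1 + m + 1 - h - 1 = m + 1 by omega, show h + 1 + m - h - 1 = m by omega,
            show h + 1 + m + 2 - h - 1 = m + 2 by omega]
          field_simp
          ring
  rw [h01, Finset.sum_congr rfl fun i _ => hterm i, Finset.sum_sub_distrib, ← Finset.mul_sum,
    Finset.sum_add_distrib]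
  simp only [Finset.sum_ite_eq', Finset.mem_univ, if_true, dotProduct]
  ring

theorem tauN_even :
    tauN (2 * h) w = (w + 1) ^ 2 * (w - 1) / (w * (w ^ (2 * h) - 1)) := by
  have : ⌈((2 * h : ℕ) : ℝ) / 2⌉₊ = h := by
    push_cast
    rw [mul_div_cancel_left₀ _ two_ne_zero, Nat.ceil_natCast]
  rw [tauN, this]

theorem tauN_nonneg {n : ℕ} (hw : 1 < w) : 0 ≤ tauN n w := by
  have : 1 ≤ w ^ (2 * ⌈(n : ℝ) / 2⌉₊) := one_le_pow₀ hw.le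
  rw [tauN]
  exact div_nonneg (mul_nonneg (sq_nonneg _) (by linarith))
    (mul_nonneg (by linarith) (by linarith))

theorem even_le_loopedPathEigenvalue_one (hh : 1 ≤ h) (hw : 1 < w) :
    w + 1 / w - tauN (2 * h) w ≤ loopedPathEigenvalue (2 * h) w ⟨1, by omega⟩ := by
  have hw0 : 0 < w := by linarith
  refine le_loopedPathEigenvalue_one (by omega) hw (G := splitSeq h w) splitSeq_rev ?_
    (by linarith [tauN_nonneg (n := 2 * h) hw]) ?_
  · simp only [splitSeq, hh, if_true]
    positivity
  · rw [splitSeq_quadratic hh hw, splitSeq_dotProduct_self hw, tauN_even]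
    have h1 : w ^ (2 * h) - 1 ≠ 0 := by
      have := one_lt_pow₀ hw (show 2 * h ≠ 0 by omega)
      linarith
    have h2 : w ^ 2 - 1 ≠ 0 := by nlinarith
    have hcalc : (w + 1) ^ 2 * (w - 1) / (w * (w ^ (2 * h) - 1)) *
        (2 * ((w ^ (2 * h) - 1) / (w ^ 2 - 1))) = 2 * (1 + 1 / w) := by
      field_simp
      ring
    rw [sub_mul, hcalc]

end EvenOrder

/-! ### Odd n: λ₂ > 2 for n ≥ 5, and λ₂ ≥ w for n = 3 -/

section OddOrder

variable {h : ℕ} {w : ℝ}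

theorem tauN_odd : tauN (2 * h + 1) w =
    (w + 1) ^ 2 * (w - 1) / (w * (w ^ (2 * (h + 1)) - 1)) := by
  have : ⌈((2 * h + 1 : ℕ) : ℝ) / 2⌉₊ = h + 1 := by
    rw [Nat.ceil_eq_iff (by omega)]
    push_cast
    constructor <;> linarith
  rw [tauN, this]

theorem sum_pow_le_of_mul_le (hh : 2 ≤ h) (hw0 : 0 ≤ w) (hle : h * w ≤ h + 1) :
    ∑ i ∈ Finset.range (h + 1), (w ^ 2) ^ i ≤ h * (2 * h + 1) := by
  have hpos : (0 : ℝ) < h := by exact_mod_cast (by omega : 0 < h)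
  have hw : w ≤ 1 + 1 / h := by
    rw [← mul_le_mul_iff_right₀ hpos]
    refine hle.trans_eq ?_
    field_simp
  have hmono : ∑ i ∈ Finset.range (h + 1), (w ^ 2) ^ i ≤
      ∑ i ∈ Finset.range (h + 1), ((1 + 1 / (h : ℝ)) ^ 2) ^ i := by
    gcongr
  refine hmono.trans ?_
  -- Every summand is at most (1 + 1/h)^(2h) ≤ e² < 7.4, and 7.4 (h + 1) ≤ h (2h + 1) holds from h =
  -- 5 on; smaller cases are numerical.
  rcases Nat.lt_or_ge h 5 with hlt | hge
  · interval_cases h <;> norm_num [Finset.sum_range_succ]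
  · have h5 : (5 : ℝ) ≤ h := by exact_mod_cast hge
    have hexp : (1 + 1 / (h : ℝ)) ^ (2 * h) ≤ 7.4 := by
      calc (1 + 1 / (h : ℝ)) ^ (2 * h) ≤ (Real.exp (1 / h)) ^ (2 * h) := by
            gcongr
            linarith [Real.add_one_le_exp (1 / (h : ℝ))]
        _ = Real.exp 1 ^ 2 := by
            rw [mul_comm, pow_mul, ← Real.exp_nat_mul, mul_one_div_cancel hpos.ne']
        _ ≤ 2.7182818286 ^ 2 := by
            gcongr
            exact Real.exp_one_lt_d9.le
        _ ≤ 7.4 := by norm_num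
    have hbd : ∑ i ∈ Finset.range (h + 1), ((1 + 1 / (h : ℝ)) ^ 2) ^ i ≤ ((h : ℝ) + 1) * 7.4 := by
      refine (Finset.sum_le_card_nsmul _ _ (7.4 : ℝ) fun i hi => ?_).trans_eq ?_
      · rw [← pow_mul]
        refine (pow_le_pow_right₀ ?_ ?_).trans hexp
        · have : 0 < 1 / (h : ℝ) := by positivity
          linarith
        · rw [Finset.mem_range] at hi
          omega
      · rw [Finset.card_range, nsmul_eq_mul]
        push_cast
        ring
    nlinarith

/-- The hypothesis amounts to (w + 1)² < (w - 1)(w^(2h+2) - 1), which the bound on the geometric sum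
contradicts when w ≤ 1 + 1/h. The conclusion is what makes the boundary term of the linear test
vector positive. -/
theorem lt_mul_of_two_lt (hh : 2 ≤ h) (hw : 1 < w) (hτ : 2 < w + 1 / w - tauN (2 * h + 1) w) :
    (h : ℝ) + 1 < h * w := by
  by_contra! hle
  have hw0 : 0 < w := by linarith
  have hw1 : 0 < w - 1 := by linarith
  have hsum := sum_pow_le_of_mul_le hh hw0.le hle
  rw [geom_sum_eq (by nlinarith : w ^ 2 ≠ 1), ← pow_mul, div_le_iff₀ (by nlinarith)] at hsum
  have hW : 0 < w ^ (2 * (h + 1)) - 1 := by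
    have := one_lt_pow₀ hw (show 2 * (h + 1) ≠ 0 by omega)
    linarith
  rw [tauN_odd] at hτ
  have hτ' : (w + 1) ^ 2 * (w - 1) / (w * (w ^ (2 * (h + 1)) - 1)) < (w - 1) ^ 2 / w := by
    have : (w - 1) ^ 2 / w = w + 1 / w - 2 := by
      field_simp
      ring
    linarith
  rw [div_lt_div_iff₀ (by positivity) hw0] at hτ'
  have h1 : (w + 1) ^ 2 < (w - 1) * (w ^ (2 * (h + 1)) - 1) := by
    have hc : 0 < w * (w - 1) := by positivity
    nlinarith
  have hhw : h * (w - 1) ≤ 1 := by linarith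
  have h2 : (w - 1) * (w ^ (2 * (h + 1)) - 1) ≤ (2 * h + 1) * (w ^ 2 - 1) := by
    have hnn : 0 ≤ (2 * h + 1) * (w ^ 2 - 1) := by
      have : 0 ≤ w ^ 2 - 1 := by nlinarith
      positivity
    nlinarith [mul_le_mul_of_nonneg_left hsum hw1.le, mul_le_mul_of_nonneg_right hhw hnn]
  nlinarith

/-- The antisymmetric linear test sequence. -/
theorem linear_test_vector {n : ℕ} (hn : 2 ≤ n) (w : ℝ) :
    innerVec n (fun k => 2 * (k : ℝ) - (n + 1)) ⬝ᵥ
      (loopedPathMatrix n w *ᵥ innerVec n (fun k => 2 * (k : ℝ) - (n + 1))) =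
    2 * (innerVec n (fun k => 2 * (k : ℝ) - (n + 1)) ⬝ᵥ
      innerVec n (fun k => 2 * (k : ℝ) - (n + 1))) + 2 * ((n - 1) * (w * (n - 1) - (n + 1))) := by
  rw [innerVec_quadratic_of_recurrence hn w (ρ := -1) (y := 2) (by norm_num)]
  · push_cast
    ring
  · intro k hk
    push_cast [Nat.cast_sub hk]
    ring
  · intro i _
    push_cast
    ring

theorem two_lt_loopedPathEigenvalue_one {n : ℕ} (hn : 2 ≤ n) (hw : 1 < w)
    (hnw : (n : ℝ) + 1 < w * (n - 1)) : 2 < loopedPathEigenvalue n w ⟨1, hn⟩ := by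
  have hn' : (2 : ℝ) ≤ n := by exact_mod_cast hn
  have hw0 : 0 < w := by linarith
  have hquad := linear_test_vector hn w
  set G : ℕ → ℝ := fun k => 2 * (k : ℝ) - (n + 1) with hG
  have hG1 : G 1 ≠ 0 := by
    simp only [hG, Nat.cast_one]
    linarith
  have hS : 0 < innerVec n G ⬝ᵥ innerVec n G :=
    dotProduct_self_pos_of_ne_zero (f := innerVec n G) ⟨0, pos_of_gt hn⟩ hG1
  have hgap : 0 < 2 * (((n : ℝ) - 1) * (w * (n - 1) - (n + 1))) :=
    mul_pos two_pos (mul_pos (by linarith) (by linarith))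
  -- The minimum respects the cap w + 1/w in `le_loopedPathEigenvalue_one`.
  have hy : 2 < min (w + 1 / w)
      (2 + 2 * (((n : ℝ) - 1) * (w * (n - 1) - (n + 1))) / (innerVec n G ⬝ᵥ innerVec n G)) :=
    lt_min (two_lt_add_inv hw) (by linarith [div_pos hgap hS])
  refine hy.trans_le (le_loopedPathEigenvalue_one hn hw (G := G) ?_ hG1 (min_le_left _ _) ?_)
  · intro k hk
    simp only [hG]
    push_cast [Nat.cast_sub hk]
    ring
  · refine (mul_le_mul_of_nonneg_right (min_le_right _ _) hS.le).trans_eq ?_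
    rw [hquad, add_mul, div_mul_cancel₀ _ hS.ne']

theorem le_loopedPathEigenvalue_one_three (hw : 1 < w) :
    w ≤ loopedPathEigenvalue 3 w ⟨1, by omega⟩ := by
  have hquad := linear_test_vector (n := 3) (by omega) w
  refine le_loopedPathEigenvalue_one (by omega) hw (G := fun k => 2 * (k : ℝ) - ((3 : ℕ) + 1))
    ?_ (by norm_num) (by have : 0 < 1 / w := by positivity
                         linarith) ?_
  · intro k hk
    push_cast [Nat.cast_sub hk]
    ring
  · rw [hquad]
    simp only [innerVec, dotProduct, Fin.sum_univ_three]
    norm_num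
    linarith

end OddOrder

/-! ### Odd n: using the correction term of b as slack -/

section SlackBounds

variable {h : ℕ} {w : ℝ}

/-- When `h (w² - 1) ≥ 4`, there is a `q` at which the correction term of `bFun` is used up
exactly and whose antisymmetric geometric vector has Rayleigh quotient at least `q + 1 / q`. -/
theorem exists_ratio (hh : 2 ≤ h) (hw : 1 < w) (hp : 4 ≤ h * (w ^ 2 - 1)) :
    ∃ q : ℝ, 1 < q ∧ q < w ∧ w * q - 1 ≤ q ^ (2 * h + 1) * (w - q) ∧
      2 * q ^ 2 / (q ^ 2 - 1) =
        2 * w ^ 2 / (w ^ 2 - 1) + 16 * w ^ 2 / (2 * h * (w ^ 2 - 1) ^ 2) := by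
  have hw0 : 0 < w := by linarith
  have hh2 : (2 : ℝ) ≤ h := by exact_mod_cast hh
  obtain ⟨u, hu⟩ : ∃ u, u = w ^ 2 - 1 := ⟨_, rfl⟩
  have hu0 : 0 < u := by rw [hu]; nlinarith
  have hw2 : w ^ 2 = u + 1 := by linarith
  obtain ⟨p, hpdef⟩ : ∃ p, p = h * u := ⟨_, rfl⟩
  have hp4 : 4 ≤ p := by rw [hpdef, hu]; exact hp
  have hup : 2 * u ≤ p := by rw [hpdef]; nlinarith
  obtain ⟨D, hD⟩ : ∃ D, D = p + 4 * w ^ 2 := ⟨_, rfl⟩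
  have hD0 : 0 < D := by rw [hD]; positivity
  have hqsq : √(w ^ 2 * (p + 4) / D) ^ 2 = w ^ 2 * (p + 4) / D :=
    Real.sq_sqrt (by positivity)
  -- Solving the required equation for q² with u = w² - 1 and p = h u gives q² = w² (p + 4) / (p + 4
  -- w²).
  set q := √(w ^ 2 * (p + 4) / D) with hq
  have hqn : 0 ≤ q := Real.sqrt_nonneg _
  have hqD : q ^ 2 * D = w ^ 2 * (p + 4) := by rw [hqsq]; field_simp
  have hq1D : (q ^ 2 - 1) * D = u * p := by
    rw [sub_mul, hqD, hD, hw2]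
    ring
  have hq1 : 0 < q ^ 2 - 1 := by
    by_contra! hcon
    nlinarith [mul_pos hu0 (show 0 < p by linarith)]
  have hq1' : 1 < q := by nlinarith
  have hwqD : (w ^ 2 - q ^ 2) * D = 4 * w ^ 2 * u := by
    rw [sub_mul, hqD, hD, hw2]
    ring
  have hqw : q < w := by
    have : 0 < w ^ 2 - q ^ 2 := by
      by_contra! hcon
      nlinarith [mul_pos (show 0 < 4 * w ^ 2 by positivity) hu0]
    nlinarith
  refine ⟨q, hq1', hqw, ?_, ?_⟩
  · have hbern : D + h * (u * p) ≤ D * (q ^ 2) ^ h := by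
      have := one_add_mul_add_le_pow hq1.le h
      rw [add_sub_cancel] at this
      have h2 : 1 + h * (q ^ 2 - 1) ≤ (q ^ 2) ^ h := by
        have : 0 ≤ (h : ℝ) * (h - 1) / 2 * (q ^ 2 - 1) ^ 2 := by
          have : (0 : ℝ) ≤ h - 1 := by linarith
          positivity
        linarith
      have h3 := mul_le_mul_of_nonneg_left h2 hD0.le
      nlinarith
    -- This is √(1 + s) ≤ 1 + s/2 with s = 4u/(p + 4), as D = p + 4 + 4u.
    have hratio : (p + 4) * w ≤ q * (p + 4 + 2 * u) := by
      refine abs_le_of_sq_le_sq' ?_ (by positivity) |>.2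
      have : ((p + 4) * w) ^ 2 = (p + 4) * (q ^ 2 * D) := by rw [hqD]; ring
      rw [this, mul_pow, hD, hw2]
      nlinarith [mul_nonneg (sq_nonneg q) (sq_nonneg u)]
    -- Both p ≥ 4 and 2u ≤ p, the latter from h ≥ 2, are used here.
    have hpoly : (2 * (p + 4) + 2 * u) * D ≤ 4 * w ^ 2 * p * (p + 4) := by
      rw [hD, hw2]
      have h1 : 0 ≤ (p + 4) * (p - 4) := mul_nonneg (by linarith) (by linarith)
      have h2 : u * (2 * u) ≤ u * p := mul_le_mul_of_nonneg_left hup hu0.le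
      have h3 : 0 ≤ u * ((p + 4) * (2 * p - 8)) :=
        mul_nonneg hu0.le (mul_nonneg (by linarith) (by linarith))
      nlinarith [mul_nonneg hu0.le (show 0 ≤ p by linarith)]
    have hmid : (q + w) * D ≤ 4 * w ^ 2 * p * q := by
      have e1 : (p + 4) * (q + w) ≤ q * (2 * (p + 4) + 2 * u) := by linarith
      have e2 := mul_le_mul_of_nonneg_right e1 hD0.le
      have e3 := mul_le_mul_of_nonneg_left hpoly hqn
      have hp0 : 0 < p + 4 := by linarith
      refine le_of_mul_le_mul_left ?_ hp0
      linarith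
    -- This factor turns w - q and q² - 1 into the products with D computed above.
    have hcoef : 0 < (w + q) * D ^ 2 := by positivity
    refine le_of_mul_le_mul_right ?_ hcoef
    have e1 : q ^ (2 * h + 1) = q * (q ^ 2) ^ h := by rw [pow_succ', pow_mul]
    have e2 : (w * q - 1) * ((w + q) * D ^ 2) = D * u * (q * D + w * p) := by
      have : (w * q - 1) * (w + q) = q * u + w * (q ^ 2 - 1) := by rw [hu]; ring
      calc _ = ((w * q - 1) * (w + q)) * D ^ 2 := by ring
        _ = D * (q * u * D + w * ((q ^ 2 - 1) * D)) := by rw [this]; ring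
        _ = _ := by rw [hq1D]; ring
    have e3 : q ^ (2 * h + 1) * (w - q) * ((w + q) * D ^ 2) =
        4 * w ^ 2 * u * q * (D * (q ^ 2) ^ h) := by
      calc _ = q ^ (2 * h + 1) * ((w ^ 2 - q ^ 2) * D) * D := by ring
        _ = _ := by rw [hwqD, e1]; ring
    rw [e2, e3]
    have e4 := mul_le_mul_of_nonneg_left hbern (show 0 ≤ 4 * w ^ 2 * u * q by positivity)
    refine le_trans ?_ e4
    have e5 : (h : ℝ) * (u * p) = p ^ 2 := by rw [hpdef]; ring
    have e6 : D * u * (q * D + w * p) = u * (D * (q * (4 * w ^ 2)) + p * ((q + w) * D)) := by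
      rw [hD]
      ring
    rw [e5, e6]
    have e7 := mul_le_mul_of_nonneg_left hmid (show 0 ≤ u * p by positivity)
    nlinarith
  · have hp0 : 0 < p := by linarith
    have e1 : 2 * q ^ 2 / (q ^ 2 - 1) = 2 * (q ^ 2 * D) / ((q ^ 2 - 1) * D) := by
      field_simp
    rw [e1, hqD, hq1D, ← hu, hpdef]
    have : (0 : ℝ) < h := by linarith
    field_simp
    ring

/-- The inequality from `exists_ratio` says that w G 1 - G 0 ≤ 0; as G 1 < 0 too, the boundary term
is nonnegative. -/
theorem exists_le_second_eigenvalue (hh : 2 ≤ h) (hw : 1 < w) (hp : 4 ≤ h * (w ^ 2 - 1)) :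
    ∃ q : ℝ, 1 < q ∧ q + 1 / q ≤ loopedPathEigenvalue (2 * h + 1) w ⟨1, by omega⟩ ∧
      2 * q ^ 2 / (q ^ 2 - 1) =
        2 * w ^ 2 / (w ^ 2 - 1) + 16 * w ^ 2 / (2 * h * (w ^ 2 - 1) ^ 2) := by
  obtain ⟨q, hq1, hqw, hmain, heq⟩ := exists_ratio hh hw hp
  refine ⟨q, hq1, ?_, heq⟩
  have hw0 : 0 < w := by linarith
  have hq0 : 0 < q := by linarith
  have hG1 : geomSeq (2 * h + 1) q (-1) 1 < 0 := by
    have := pow_lt_pow_right₀ hq1 (show 1 < 2 * h + 1 by omega)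
    simp only [geomSeq, Nat.add_sub_cancel]
    linarith
  have hb : w * geomSeq (2 * h + 1) q (-1) 1 - geomSeq (2 * h + 1) q (-1) 0 ≤ 0 := by
    simp only [geomSeq, Nat.add_sub_cancel, Nat.sub_zero, pow_succ _ (2 * h + 1), pow_zero]
    linarith
  refine le_loopedPathEigenvalue_one (by omega) hw (G := geomSeq (2 * h + 1) q (-1))
    (geomSeq_rev (by norm_num)) hG1.ne ?_ ?_
  · have hwq : 0 ≤ w * q - 1 := by nlinarith [mul_pos (sub_pos.mpr hw) (sub_pos.mpr hq1)]
    have : w + 1 / w - (q + 1 / q) = (w - q) * (w * q - 1) / (w * q) := by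
      field_simp
      ring
    have h2 : 0 ≤ (w - q) * (w * q - 1) / (w * q) :=
      div_nonneg (mul_nonneg (by linarith) hwq) (by positivity)
    linarith
  · rw [innerVec_quadratic_of_recurrence (by omega) w (by norm_num)
      (geomSeq_rev (by norm_num)) fun i hi => geomSeq_recurrence (-1) (by positivity) hi]
    linarith [mul_nonneg_of_nonpos_of_nonpos hG1.le hb]

/-- With q = e^θ this says that sinh(mθ)/m does not decrease in m; the induction uses the three-term
recurrence and q + 1/q ≥ 2. -/
theorem pow_sub_inv_pow_succ_ge {q : ℝ} (hq : 1 < q) (m : ℕ) :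
    (m + 1) * (q ^ m - q⁻¹ ^ m) ≤ m * (q ^ (m + 1) - q⁻¹ ^ (m + 1)) := by
  have hq0 : 0 < q := by linarith
  induction m with
  | zero => simp
  | succ m ih =>
    have hpos : 0 ≤ q ^ (m + 1) - q⁻¹ ^ (m + 1) := by
      have h1 : 1 ≤ q ^ (m + 1) := one_le_pow₀ hq.le
      have h2 : q⁻¹ ^ (m + 1) ≤ 1 := pow_le_one₀ (by positivity) (inv_le_one_of_one_le₀ hq.le)
      linarith
    have hrec : q ^ (m + 2) - q⁻¹ ^ (m + 2) =
        (q + q⁻¹) * (q ^ (m + 1) - q⁻¹ ^ (m + 1)) - (q ^ m - q⁻¹ ^ m) := by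
      have : q * q⁻¹ = 1 := mul_inv_cancel₀ hq0.ne'
      linear_combination (q⁻¹ ^ m - q ^ m) * this
    have h2 : 2 ≤ q + q⁻¹ := by
      have : q + q⁻¹ - 2 = (q - 1) ^ 2 / q := by
        field_simp
        ring
      have : 0 ≤ (q - 1) ^ 2 / q := by positivity
      linarith
    have := mul_le_mul_of_nonneg_right h2 hpos
    push_cast
    rw [show m + 1 + 1 = m + 2 from rfl, hrec]
    nlinarith [mul_le_mul_of_nonneg_left this (show (0 : ℝ) ≤ m + 1 by positivity)]

theorem mul_pow_sub_inv_pow_le {q : ℝ} (hq : 1 < q) {m h : ℕ} (hmh : m ≤ h) :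
    h * (q ^ m - q⁻¹ ^ m) ≤ m * (q ^ h - q⁻¹ ^ h) := by
  induction h, hmh using Nat.le_induction with
  | base => exact le_rfl
  | succ h hmh ih =>
    rcases Nat.eq_zero_or_pos h with rfl | hpos
    · obtain rfl : m = 0 := by omega
      simp
    · have hh : (0 : ℝ) < h := by exact_mod_cast hpos
      have h1 := pow_sub_inv_pow_succ_ge hq h
      have h2 := mul_le_mul_of_nonneg_left h1 (show (0 : ℝ) ≤ m by positivity)
      have h3 := mul_le_mul_of_nonneg_left ih (show (0 : ℝ) ≤ h + 1 by positivity)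
      refine le_of_mul_le_mul_left ?_ hh
      push_cast
      linarith

theorem sum_range_sub_sq (a : ℝ) (m : ℕ) : ∑ i ∈ Finset.range m, ((i : ℝ) - a) ^ 2 =
    m * (m - 1) * (2 * m - 1) / 6 - a * (m * (m - 1)) + m * a ^ 2 := by
  induction m with
  | zero => simp
  | succ m ih =>
    rw [Finset.sum_range_succ, ih]
    push_cast
    ring

/-- Comparison of an antisymmetric hyperbolic eigenvector with the linear one. -/
theorem antisymmetric_sum_sq_le_linear (hh : 1 ≤ h) {q : ℝ} (hq : 1 < q) :
    innerVec (2 * h + 1) (geomSeq (2 * h + 1) q (-1)) ⬝ᵥ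
      innerVec (2 * h + 1) (geomSeq (2 * h + 1) q (-1)) ≤
    geomSeq (2 * h + 1) q (-1) 1 ^ 2 * ((h + 1) * (2 * h + 1) / (3 * h)) := by
  have hq0 : q ≠ 0 := by positivity
  have hh0 : (0 : ℝ) < h := by exact_mod_cast hh
  -- Around the centre h + 1 the entries are proportional to sinh(mθ), m being the distance. They
  -- are compared with the line through the end entry; summing (m/h)² gives the constant.
  have hlow : ∀ m ≤ h, geomSeq (2 * h + 1) q (-1) (h + 1 - m) =
      -(q ^ (h + 1) * (q ^ m - q⁻¹ ^ m)) := by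
    intro m hm
    have e1 : q ^ (h + 1) = q ^ (h + 1 - m) * q ^ m := by rw [← pow_add]; congr 1; omega
    have e2 : 2 * h + 1 + 1 - (h + 1 - m) = h + 1 + m := by omega
    simp only [geomSeq, e2]
    have : q ^ m * q⁻¹ ^ m = 1 := by rw [← mul_pow, mul_inv_cancel₀ hq0, one_pow]
    rw [pow_add q (h + 1) m, e1]
    linear_combination (-q ^ (h + 1 - m)) * this
  have hnn : ∀ m : ℕ, 0 ≤ q ^ m - q⁻¹ ^ m := fun m => by
    have h1 : 1 ≤ q ^ m := one_le_pow₀ hq.le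
    have h2 : q⁻¹ ^ m ≤ 1 := pow_le_one₀ (by positivity) (inv_le_one_of_one_le₀ hq.le)
    linarith
  have hfirst : geomSeq (2 * h + 1) q (-1) 1 = -(q ^ (h + 1) * (q ^ h - q⁻¹ ^ h)) := by
    rw [← hlow h le_rfl]
    congr 1
    omega
  have hsq : ∀ m ≤ h, (h : ℝ) ^ 2 * geomSeq (2 * h + 1) q (-1) (h + 1 - m) ^ 2 ≤
      (m : ℝ) ^ 2 * geomSeq (2 * h + 1) q (-1) 1 ^ 2 := by
    intro m hm
    rw [hlow m hm, hfirst]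
    have := pow_le_pow_left₀ (mul_nonneg hh0.le (hnn m)) (mul_pow_sub_inv_pow_le hq hm) 2
    have := mul_le_mul_of_nonneg_left this (sq_nonneg (q ^ (h + 1)))
    nlinarith
  have hterm : ∀ i ∈ Finset.range (2 * h + 1),
      (h : ℝ) ^ 2 * (geomSeq (2 * h + 1) q (-1) (i + 1) * geomSeq (2 * h + 1) q (-1) (i + 1)) ≤
      ((i : ℝ) - h) ^ 2 * geomSeq (2 * h + 1) q (-1) 1 ^ 2 := by
    intro i hi
    rw [Finset.mem_range] at hi
    rcases le_total i h with hle | hle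
    · have := hsq (h - i) (by omega)
      rw [show h + 1 - (h - i) = i + 1 by omega, Nat.cast_sub hle] at this
      nlinarith
    · have := hsq (i - h) (by omega)
      have e : geomSeq (2 * h + 1) q (-1) (i + 1) =
          -1 * geomSeq (2 * h + 1) q (-1) (h + 1 - (i - h)) := by
        rw [← geomSeq_rev (by norm_num) _ (by omega)]
        congr 1
        omega
      rw [Nat.cast_sub hle] at this
      rw [e]
      nlinarith
  have hsum : innerVec (2 * h + 1) (geomSeq (2 * h + 1) q (-1)) ⬝ᵥ
      innerVec (2 * h + 1) (geomSeq (2 * h + 1) q (-1)) =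
      ∑ i ∈ Finset.range (2 * h + 1),
        geomSeq (2 * h + 1) q (-1) (i + 1) * geomSeq (2 * h + 1) q (-1) (i + 1) := by
    rw [dotProduct, Finset.sum_range]
    rfl
  rw [hsum]
  refine le_of_mul_le_mul_left ?_ (show (0 : ℝ) < h ^ 2 by positivity)
  rw [Finset.mul_sum]
  refine (Finset.sum_le_sum hterm).trans_eq ?_
  rw [← Finset.sum_mul, sum_range_sub_sq]
  push_cast
  field_simp
  ring

end SlackBounds

theorem bFun_add_inv_le {n : ℕ} (hn : 2 ≤ n) {q : ℝ} (hq : 1 < q) :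
    bFun n (q + 1 / q) ≤ (2 * q ^ 2 / (q ^ 2 - 1))⁻¹ := by
  have hz : 0 < q ^ 2 - 1 := by nlinarith
  have hn' : (0 : ℝ) < n - 1 := by
    have : (2 : ℝ) ≤ n := by exact_mod_cast hn
    linarith
  rw [bFun_add_inv n hq]
  refine inv_anti₀ (by positivity) (le_add_of_nonneg_right (by positivity))

theorem inv_two_mul_sq_div_mono {q r : ℝ} (hq : 1 < q) (hr : 1 < r) (hqr : q + 1 / q ≤ r + 1 / r) :
    (2 * q ^ 2 / (q ^ 2 - 1))⁻¹ ≤ (2 * r ^ 2 / (r ^ 2 - 1))⁻¹ := by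
  have hle : q ≤ r := by
    by_contra! h
    have h1 : q + 1 / q - (r + 1 / r) = (q - r) * (q * r - 1) / (q * r) := by
      field_simp
      ring
    have h2 : 0 < q * r - 1 := by nlinarith [mul_pos (sub_pos.mpr hq) (sub_pos.mpr hr)]
    have h3 : 0 < (q - r) * (q * r - 1) / (q * r) :=
      div_pos (mul_pos (by linarith) h2) (by positivity)
    linarith
  have hq2 : 0 < q ^ 2 - 1 := by nlinarith
  have hr2 : 0 < r ^ 2 - 1 := by nlinarith
  refine inv_anti₀ (by positivity) ?_
  rw [div_le_div_iff₀ hr2 hq2]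
  nlinarith [pow_le_pow_left₀ (by linarith) hle 2]

/-- Near `x = 2` the function `bFun` is dominated by the linear eigenvector. -/
theorem bFun_le_linear {h : ℕ} (hh : 1 ≤ h) {x : ℝ} (hx : 2 < x)
    (hX : h ^ 2 * (x ^ 2 - 4) ≤ 16) :
    bFun (2 * h + 1) x ≤ ((h + 1) * (2 * h + 1) / (3 * h) : ℝ)⁻¹ := by
  have hh1 : (1 : ℝ) ≤ h := by exact_mod_cast hh
  have hX0 : 0 < x ^ 2 - 4 := by nlinarith
  -- The square root and the correction term each contribute at least h/2, so 1/b ≥ 1 + h.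
  have h1 : (h : ℝ) / 2 ≤ √(1 + 4 / (x ^ 2 - 4)) := by
    refine Real.le_sqrt_of_sq_le ?_
    have : (h : ℝ) ^ 2 / 4 ≤ 4 / (x ^ 2 - 4) := by
      rw [div_le_div_iff₀ (by norm_num) hX0]
      linarith
    nlinarith
  have h2 : (h : ℝ) / 2 ≤ 16 / (((2 * h + 1 : ℕ) : ℝ) - 1) / (x ^ 2 - 4) := by
    push_cast
    rw [add_sub_cancel_right, div_div, div_le_div_iff₀ (by norm_num) (by positivity)]
    linarith
  rw [div_div] at h2
  rw [bFun_eq hx]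
  refine inv_anti₀ (by positivity) ?_
  have h3 : ((h : ℝ) + 1) * (2 * h + 1) / (3 * h) ≤ 1 + h := by
    rw [div_le_iff₀ (by positivity)]
    nlinarith
  linarith

/-! ### The first two rows of the diagonalizing matrix -/

section Diagonalization

variable {n : ℕ} {w : ℝ} {V : Matrix (Fin n) (Fin n) ℝ}

theorem row_eigenvector (hV : V * Vᵀ = 1)
    (hA : loopedPathMatrix n w = Vᵀ * diagonal (loopedPathEigenvalue n w) * V) (k : Fin n) :
    loopedPathMatrix n w *ᵥ V k = loopedPathEigenvalue n w k • V k ∧ V k ⬝ᵥ V k = 1 ∧ V k ≠ 0 := by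
  have h1 : V k ⬝ᵥ V k = 1 := by rw [dotProduct_row_of_orthogonal hV, if_pos rfl]
  refine ⟨mulVec_row_of_diagonalization hV hA k, h1, fun h => ?_⟩
  rw [h, zero_dotProduct] at h1
  exact zero_ne_one h1

theorem row_zero_eq (hn : 2 ≤ n) (hw : 1 < w) (hV : V * Vᵀ = 1)
    (hA : loopedPathMatrix n w = Vᵀ * diagonal (loopedPathEigenvalue n w) * V) :
    ∃ q P : ℝ, 1 < q ∧ loopedPathEigenvalue n w ⟨0, pos_of_gt hn⟩ = q + 1 / q ∧
      V ⟨0, pos_of_gt hn⟩ = P • innerVec n (geomSeq n q 1) := by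
  have hlam := le_loopedPathEigenvalue_zero hn hw
  obtain ⟨hf, -, hf0⟩ := row_eigenvector hV hA ⟨0, pos_of_gt hn⟩
  obtain ⟨q, hq, hlq⟩ := exists_eq_add_inv ((two_lt_add_inv hw).trans_le hlam)
  rw [hlq] at hf hlam
  obtain ⟨ρ, P, hρ | hρ, -, hfP, hb⟩ := eigenvector_eq_geomSeq hn hq hf hf0
  · exact ⟨q, P, hq, hlq, by rw [hfP, hρ]⟩
  -- An antisymmetric first eigenvector would force q < w, against λ₁ ≥ w + 1/w.
  · rw [hρ] at hb
    have hqw := geomSeq_boundary_lt hw hq hb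
    have h1 : w + 1 / w - (q + 1 / q) = (w - q) * (w * q - 1) / (w * q) := by
      field_simp
      ring
    have h2 : 0 < w * q - 1 := by nlinarith [mul_pos (sub_pos.mpr hw) (sub_pos.mpr hq)]
    have h3 : 0 < (w - q) * (w * q - 1) / (w * q) :=
      div_pos (mul_pos (by linarith) h2) (by positivity)
    linarith

theorem row_one_eq (hn : 2 ≤ n) (hw : 1 < w) (hV : V * Vᵀ = 1)
    (hA : loopedPathMatrix n w = Vᵀ * diagonal (loopedPathEigenvalue n w) * V)
    (hlam : 2 < loopedPathEigenvalue n w ⟨1, hn⟩) :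
    ∃ q P : ℝ, 1 < q ∧ loopedPathEigenvalue n w ⟨1, hn⟩ = q + 1 / q ∧
      V ⟨1, hn⟩ = P • innerVec n (geomSeq n q (-1)) := by
  obtain ⟨hf, -, hf0⟩ := row_eigenvector hV hA ⟨1, hn⟩
  obtain ⟨q, hq, hlq⟩ := exists_eq_add_inv hlam
  rw [hlq] at hf
  obtain ⟨ρ, P, hρ | hρ, hP, hfP, -⟩ := eigenvector_eq_geomSeq hn hq hf hf0
  · obtain ⟨r, R, hr, -, hfR⟩ := row_zero_eq hn hw hV hA
    have horth := dotProduct_row_of_orthogonal hV ⟨0, pos_of_gt hn⟩ ⟨1, hn⟩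
    have hR : R ≠ 0 := by
      rintro rfl
      exact (row_eigenvector hV hA ⟨0, pos_of_gt hn⟩).2.2 (by rw [hfR, zero_smul])
    rw [if_neg (by simp), hfR, hfP, hρ, smul_dotProduct, dotProduct_smul, smul_eq_mul,
      smul_eq_mul] at horth
    have := geomSeq_dotProduct_pos hn hr hq (Or.inl rfl)
    exact absurd horth (mul_ne_zero hR (mul_ne_zero hP this.ne'))
  · exact ⟨q, P, hq, hlq, by rw [hfP, hρ]⟩

theorem row_zero_bound (hn : 2 ≤ n) (hw : 1 < w) (hV : V * Vᵀ = 1)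
    (hA : loopedPathMatrix n w = Vᵀ * diagonal (loopedPathEigenvalue n w) * V) :
    V ⟨0, pos_of_gt hn⟩ ⟨n - 1, Nat.sub_one_lt_of_lt hn⟩ = V ⟨0, pos_of_gt hn⟩ ⟨0, pos_of_gt hn⟩ ∧
      bFun n (w + 1 / w) ≤ V ⟨0, pos_of_gt hn⟩ ⟨0, pos_of_gt hn⟩ ^ 2 := by
  obtain ⟨q, P, hq, hlq, hfP⟩ := row_zero_eq hn hw hV hA
  constructor
  · have h := innerVec_rev (geomSeq_rev (n := n) (q := q) (ρ := 1) (by norm_num)) ⟨0, pos_of_gt hn⟩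
    rw [one_mul] at h
    rw [hfP, Pi.smul_apply, Pi.smul_apply, ← h]
    rfl
  · refine (bFun_mono hn (two_lt_add_inv hw) (le_loopedPathEigenvalue_zero hn hw)).trans ?_
    rw [hlq]
    exact unit_symmetric_eigenvector_bound hn hq hfP (row_eigenvector hV hA _).2.1

theorem row_one_antisymmetric (hn : 2 ≤ n) (hw : 1 < w) (hV : V * Vᵀ = 1)
    (hA : loopedPathMatrix n w = Vᵀ * diagonal (loopedPathEigenvalue n w) * V)
    (hlam : 2 < loopedPathEigenvalue n w ⟨1, hn⟩) :
    V ⟨1, hn⟩ ⟨n - 1, Nat.sub_one_lt_of_lt hn⟩ = -V ⟨1, hn⟩ ⟨0, pos_of_gt hn⟩ := by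
  obtain ⟨q, P, hq, hlq, hfP⟩ := row_one_eq hn hw hV hA hlam
  have h := innerVec_rev (geomSeq_rev (n := n) (q := q) (ρ := -1) (by norm_num)) ⟨0, pos_of_gt hn⟩
  rw [neg_one_mul] at h
  rw [hfP, Pi.smul_apply, Pi.smul_apply, ← smul_neg, ← h]
  rfl

end Diagonalization

/-! ### The bound on the second eigenvector, by parity of n -/

theorem row_one_bound_even {h : ℕ} {w : ℝ} {V : Matrix (Fin (2 * h)) (Fin (2 * h)) ℝ}
    (hh : 1 ≤ h) (hw : 1 < w) (hV : V * Vᵀ = 1)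
    (hA : loopedPathMatrix (2 * h) w = Vᵀ * diagonal (loopedPathEigenvalue (2 * h) w) * V)
    (hτ : 2 < w + 1 / w - tauN (2 * h) w) :
    V ⟨1, by omega⟩ ⟨2 * h - 1, by omega⟩ = -V ⟨1, by omega⟩ ⟨0, by omega⟩ ∧
      bFun (2 * h) (w + 1 / w - tauN (2 * h) w) ≤ V ⟨1, by omega⟩ ⟨0, by omega⟩ ^ 2 := by
  have hlam := even_le_loopedPathEigenvalue_one hh hw
  refine ⟨row_one_antisymmetric (by omega) hw hV hA (hτ.trans_le hlam), ?_⟩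
  obtain ⟨q, P, hq, hlq, hfP⟩ := row_one_eq (by omega) hw hV hA (hτ.trans_le hlam)
  refine (bFun_mono (by omega) hτ hlam).trans ?_
  rw [hlq]
  exact (bFun_add_inv_le (by omega) hq).trans
    (unit_antisymmetric_eigenvector_bound (by omega) hq hfP (row_eigenvector hV hA _).2.1)

theorem row_one_bound_odd {h : ℕ} {w : ℝ} {V : Matrix (Fin (2 * h + 1)) (Fin (2 * h + 1)) ℝ}
    (hh : 2 ≤ h) (hw : 1 < w) (hV : V * Vᵀ = 1)
    (hA : loopedPathMatrix (2 * h + 1) w =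
      Vᵀ * diagonal (loopedPathEigenvalue (2 * h + 1) w) * V)
    (hτ : 2 < w + 1 / w - tauN (2 * h + 1) w) :
    V ⟨1, by omega⟩ ⟨2 * h + 1 - 1, by omega⟩ = -V ⟨1, by omega⟩ ⟨0, by omega⟩ ∧
      bFun (2 * h + 1) (w + 1 / w - tauN (2 * h + 1) w) ≤ V ⟨1, by omega⟩ ⟨0, by omega⟩ ^ 2 := by
  have hw0 : 0 < w := by linarith
  have hh2 : (2 : ℝ) ≤ h := by exact_mod_cast hh
  have hlam : 2 < loopedPathEigenvalue (2 * h + 1) w ⟨1, by omega⟩ := by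
    refine two_lt_loopedPathEigenvalue_one (by omega) hw ?_
    push_cast
    linarith [lt_mul_of_two_lt hh hw hτ]
  refine ⟨row_one_antisymmetric (by omega) hw hV hA hlam, ?_⟩
  obtain ⟨q, P, hq, hlq, hfP⟩ := row_one_eq (by omega) hw hV hA hlam
  have hunit := (row_eigenvector hV hA ⟨1, by omega⟩).2.1
  have hxw : w + 1 / w - tauN (2 * h + 1) w ≤ w + 1 / w := by
    linarith [tauN_nonneg (n := 2 * h + 1) hw]
  rcases le_or_gt 4 (h * (w ^ 2 - 1)) with hp | hp
  -- Here b at w + 1/w already bounds b₂ and equals the antisymmetric bound at ratio r, so λ₂ ≥ r +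
  -- 1/r is enough.
  · obtain ⟨r, hr, hrlam, hreq⟩ := exists_le_second_eigenvalue hh hw hp
    rw [hlq] at hrlam
    refine (bFun_mono (by omega) hτ hxw).trans ?_
    refine le_trans (le_of_eq ?_) ((inv_two_mul_sq_div_mono hr hq hrlam).trans
      (unit_antisymmetric_eigenvector_bound (by omega) hq hfP hunit))
    rw [hreq, bFun_add_inv _ hw]
    push_cast
    rw [add_sub_cancel_right]
  · refine (bFun_le_linear (by omega) hτ ?_).trans ?_
    · have hX : (w + 1 / w - tauN (2 * h + 1) w) ^ 2 - 4 ≤ (w ^ 2 - 1) ^ 2 := by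
        have h1 := pow_le_pow_left₀ (by linarith) hxw 2
        have h2 : (w + 1 / w) ^ 2 - 4 = (w ^ 2 - 1) ^ 2 / w ^ 2 := by
          field_simp
          ring
        have h3 : (w ^ 2 - 1) ^ 2 / w ^ 2 ≤ (w ^ 2 - 1) ^ 2 :=
          div_le_self (sq_nonneg _) (one_le_pow₀ hw.le)
        linarith
      have h4 : 0 ≤ h * (w ^ 2 - 1) := mul_nonneg (by linarith) (by nlinarith)
      have h5 := mul_le_mul_of_nonneg_left hX (sq_nonneg (h : ℝ))
      nlinarith
    · have hS := antisymmetric_sum_sq_le_linear (h := h) (by omega) hq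
      rw [inv_le_iff_one_le_mul₀ (by positivity)]
      refine hunit.symm.trans_le ?_
      have h0 : V ⟨1, by omega⟩ ⟨0, by omega⟩ = P * geomSeq (2 * h + 1) q (-1) 1 := by
        rw [hfP]; rfl
      rw [h0, mul_pow, mul_assoc, hfP, smul_dotProduct, dotProduct_smul, smul_eq_mul,
        smul_eq_mul, ← mul_assoc, ← sq]
      exact mul_le_mul_of_nonneg_left hS (sq_nonneg _)

/-- Here λ₂ may be less than 2, so the geometric form is not available. Antisymmetry forces a zero
middle entry, hence squared end entry 1/2, while 1/b ≥ 2. -/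
theorem row_one_bound_three {w : ℝ} {V : Matrix (Fin 3) (Fin 3) ℝ}
    (hw : 1 < w) (hV : V * Vᵀ = 1)
    (hA : loopedPathMatrix 3 w = Vᵀ * diagonal (loopedPathEigenvalue 3 w) * V)
    (hτ : 2 < w + 1 / w - tauN 3 w) :
    V ⟨1, by omega⟩ ⟨3 - 1, by omega⟩ = -V ⟨1, by omega⟩ ⟨0, by omega⟩ ∧
      bFun 3 (w + 1 / w - tauN 3 w) ≤ V ⟨1, by omega⟩ ⟨0, by omega⟩ ^ 2 := by
  obtain ⟨hf, hunit, hf0⟩ := row_eigenvector hV hA ⟨1, by omega⟩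
  have hlam := le_loopedPathEigenvalue_one_three hw
  obtain ⟨ρ, hρ, hrev⟩ := eigenvector_parity (by omega) hf hf0
  have hmid : ∀ k : Fin 3, V k 0 + V k 2 = loopedPathEigenvalue 3 w k * V k 1 := by
    intro k
    have := congrFun (row_eigenvector hV hA k).1 1
    simpa [mulVec, dotProduct, Fin.sum_univ_three, loopedPathMatrix] using this
  have h0 : V 1 2 = ρ * V 1 0 := hrev 0
  have h1 : V 1 1 = ρ * V 1 1 := hrev 1
  change V 1 2 = -V 1 0 ∧ _ ≤ V 1 0 ^ 2
  change V 1 ⬝ᵥ V 1 = 1 at hunit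
  change w ≤ loopedPathEigenvalue 3 w 1 at hlam
  rw [dotProduct, Fin.sum_univ_three] at hunit
  rcases hρ with rfl | rfl
  · exfalso
    have hfirst : V 0 2 = V 0 0 := (row_zero_bound (by omega) hw hV hA).1
    have hlam0 : w + 1 / w ≤ loopedPathEigenvalue 3 w 0 :=
      le_loopedPathEigenvalue_zero (by omega) hw
    have horth := dotProduct_row_of_orthogonal hV 0 1
    rw [if_neg (by simp), dotProduct, Fin.sum_univ_three, hfirst, h0, one_mul] at horth
    have m0 := hmid 0
    have m1 := hmid 1
    rw [hfirst] at m0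
    rw [h0, one_mul] at m1
    have hl0 : 0 < loopedPathEigenvalue 3 w 0 := by
      linarith [two_lt_add_inv hw]
    have hl1 : 0 < loopedPathEigenvalue 3 w 1 := by linarith
    -- If both eigenvectors were symmetric, the middle rows and orthogonality would make one middle
    -- entry vanish, and with it the whole eigenvector.
    have hprod : V 0 1 * V 1 1 * (loopedPathEigenvalue 3 w 0 * loopedPathEigenvalue 3 w 1 + 2)
        = 0 := by
      linear_combination 2 * horth - 2 * V 1 0 * m0 - loopedPathEigenvalue 3 w 0 * V 0 1 * m1
    have hne : loopedPathEigenvalue 3 w 0 * loopedPathEigenvalue 3 w 1 + 2 ≠ 0 := by positivity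
    rcases mul_eq_zero.mp ((mul_eq_zero.mp hprod).resolve_right hne) with hz | hz
    · have hu0 := (row_eigenvector hV hA 0).2.1
      rw [hz] at m0
      have : V 0 0 = 0 := by linarith
      rw [dotProduct, Fin.sum_univ_three, hfirst, this, hz] at hu0
      norm_num at hu0
    · rw [hz] at m1
      have : V 1 0 = 0 := by linarith
      rw [h0, this, hz] at hunit
      norm_num at hunit
  · have hz : V 1 1 = 0 := by linarith
    refine ⟨by rw [h0, neg_one_mul], ?_⟩
    rw [h0, hz] at hunit
    have hhalf : V 1 0 ^ 2 = 2⁻¹ := by nlinarith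
    rw [hhalf, bFun_eq hτ]
    have hX : 0 < (w + 1 / w - tauN 3 w) ^ 2 - 4 := by nlinarith
    refine inv_anti₀ two_pos ?_
    have hs : 1 ≤ √(1 + 4 / ((w + 1 / w - tauN 3 w) ^ 2 - 4)) := by
      rw [Real.one_le_sqrt]
      linarith [div_pos four_pos hX]
    have : 0 < 16 / (((3 : ℕ) : ℝ) - 1) / ((w + 1 / w - tauN 3 w) ^ 2 - 4) := by
      exact div_pos (div_pos (by norm_num) (by norm_num)) hX
    rw [div_div] at this
    linarith

theorem row_one_bound {n : ℕ} {w : ℝ} {V : Matrix (Fin n) (Fin n) ℝ}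
    (hn : 2 ≤ n) (hw : 1 < w) (hV : V * Vᵀ = 1)
    (hA : loopedPathMatrix n w = Vᵀ * diagonal (loopedPathEigenvalue n w) * V)
    (hτ : 2 < w + 1 / w - tauN n w) :
    V ⟨1, hn⟩ ⟨n - 1, Nat.sub_one_lt_of_lt hn⟩ = -V ⟨1, hn⟩ ⟨0, pos_of_gt hn⟩ ∧
      bFun n (w + 1 / w - tauN n w) ≤ V ⟨1, hn⟩ ⟨0, pos_of_gt hn⟩ ^ 2 := by
  obtain ⟨h, rfl | rfl⟩ := Nat.even_or_odd' n
  · exact row_one_bound_even (by omega) hw hV hA hτ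
  · rcases Nat.lt_or_ge h 2 with hlt | hge
    · obtain rfl : h = 1 := by omega
      exact row_one_bound_three hw hV hA hτ
    · exact row_one_bound_odd hge hw hV hA hτ

theorem mainTheorem4 (n : ℕ) (hn : 2 ≤ n) (w : ℝ) (hw : 1 < w) (t : ℝ) (ht : 0 < t)
    (hτ : 2 < w + 1 / w - tauN n w) :
    transferFidelity (loopedPathMatrix n w) ⟨0, by omega⟩ ⟨n - 1, by omega⟩ t ≤
      (√(bFun n (w + 1 / w) ^ 2 + bFun n (w + 1 / w - tauN n w) ^ 2
            - 2 * bFun n (w + 1 / w) * bFun n (w + 1 / w - tauN n w)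
              * Real.cos (t * (loopedPathEigenvalue n w ⟨0, by omega⟩
                  - loopedPathEigenvalue n w ⟨1, by omega⟩)))
          + 1 - bFun n (w + 1 / w) - bFun n (w + 1 / w - tauN n w)) ^ 2 := by
  obtain ⟨V, hV, hA⟩ := exists_orthogonal_diagonalization (loopedPathMatrix_isHermitian n w)
  obtain ⟨h0, hb₁⟩ := row_zero_bound hn hw hV hA
  obtain ⟨h1, hb₂⟩ := row_one_bound hn hw hV hA hτ
  exact transferFidelity_le (l := loopedPathEigenvalue n w) hV hA (by simp) h0 h1 hb₁ hb₂ t
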